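/- **Theorem 3.8.** Let $R\in\mathbb{C}[x_1,x_2]$ be a nonzero polynomial without constant term and without linear terms, let $A=\mathbb{C}[x_1,x_2]/(R)$, and let $A_+\subset A$ be the non-unital subalgebra of classes of polynomials without constant term. For $n\ge 1$ let $C_n=A_+^{\otimes n}$ (tensor product over $\mathbb{C}$), with differential $d:C_{n}\to C_{n-1}$, $$d(a_1\otimes\cdots\otimes a_n)=\sum_{i=1}^{n-1}(-1)^{i-1}\,a_1\otimes\cdots\otimes a_ia_{i+1}\otimes\cdots\otimes a_n ,$$ (so $d=0$ on $C_1$), and let $\mathrm{Hoch}_n$ be its homology in degree $n$. Let $e_n(k)$ be the Barr–Gerstenhaber–Schack idempotents, given by $$\sum_{k}x^k e_n(k)=\frac1{n!}\sum_{\sigma\in S_n}(x-d_\sigma)(x-d_\sigma+1)\cdots(x-d_\sigma+n-1)\,\mathrm{sgn}(\sigma)\,\sigma ,$$ where $d_\sigma$ is the number of descents $\sigma(i)>\sigma(i+1)$ and $\sigma$ acts on $C_n$ by moving the factor in position $i$ to position $\sigma(i)$. They commute with $d$; let $C_{n,k}=e_n(k)C_n$ and let $H_{n,k}$ be the homology in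 degree $n$ of the subcomplex $C_{\bullet,k}$. Then for every $k\ge 1$ the maps into homology induced by the inclusions $C_{\bullet,j}\subset C_\bullet$ are injective for the components named below and give $$\mathrm{Hoch}_{2k}=H_{2k,k}\oplus H_{2k,k+1},\qquad \dim_{\mathbb C}H_{2k,k}=\dim_{\mathbb C}H_{2k,k+1}=1,$$ $$\mathrm{Hoch}_{2k-1}=H_{2k-1,k},\qquad \dim_{\mathbb C}H_{2k-1,k}=2,$$ and all other components $H_{2k,j}$ and $H_{2k-1,j}$ vanish. Moreover, there are polynomials $R_1,R_2$ without constant term with $R=x_1R_1+x_2R_2$, and for every such choice the following holds. Define the rows of chains $P^n=(P^n_1,P^n_2)$, $n\ge1$, with $P^n_i\in C_n$, by $P^1=(x_1,x_2)$ and $P^{n+1}=P^n\otimes M_n$ (matrix product with entries multiplied by $\otimes$), where $$M_n=\begin{pmatrix}R_1&-x_2\\ R_2&x_1\end{pmatrix}\ (n\text{ odd}),\qquad M_n=\begin{pmatrix}x_1&x_2\\ -R_2&R_1\end{pmatrix}\ (n\text{ even}).$$ Then for every $n\ge1$ the chains $P^n_1,P^n_2$ are closed and their classes form a basis of $\mathrm{Hoch}_n$.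 For every $k\ge 1$ the chains $e_{2k}(k)P^{2k}_1$, $e_{2k}(k+1)P^{2k}_2$ and $e_{2k-1}(k)P^{2k-1}_1,\ e_{2k-1}(k)P^{2k-1}_2$ are closed, and their classes form bases of $H_{2k,k}$, $H_{2k,k+1}$ and $H_{2k-1,k}$ respectively. -/

import Mathlib

open scoped TensorProduct

noncomputable section

namespace PlaneCurve

section BarComplex

/-! The modified Hochschild complex of a non-unital commutative `ℂ`-algebra `N`.
The `n`-chains are the `n`-fold tensor power `⨂[ℂ]^n N`. -/

variable (N : Type*) [NonUnitalCommRing N] [Module ℂ N] [IsScalarTower ℂ N N]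
  [SMulCommClass ℂ N N]

/-- Contracting a tuple is affected in a single slot, and linearly, when one entry changes. -/
theorem contractNth_update {n : ℕ} (j : Fin n) (a : Fin (n + 1) → N) (p : Fin (n + 1)) :
    ∃ (q : Fin n) (g : N →ₗ[ℂ] N), ∀ v : N,
      Fin.contractNth j.castSucc (· * ·) (Function.update a p v) =
        Function.update (Fin.contractNth j.castSucc (· * ·) a) q (g v) := by
  rcases lt_trichotomy p.val j.val with h | h | h
  · refine ⟨⟨p.val, by omega⟩, LinearMap.id, fun v => funext fun k => ?_⟩
    simp only [Fin.contractNth, Function.update_apply, Fin.ext_iff, Fin.val_castSucc,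
      Fin.val_succ, LinearMap.id_apply]
    split_ifs <;> first | rfl | omega
  · refine ⟨j, { toFun := fun v => v * a j.succ
                 map_add' := fun v w => add_mul v w _
                 map_smul' := fun r v => smul_mul_assoc r v _ }, fun v => funext fun k => ?_⟩
    simp only [Fin.contractNth, Function.update_apply, Fin.ext_iff, Fin.val_castSucc,
      Fin.val_succ, LinearMap.coe_mk, AddHom.coe_mk]
    split_ifs with h1 h2 h3 h4 h5 <;> first | rfl | omega | skip
    all_goals
      have hk : k = j := Fin.ext (by omega)
      subst hk
      rfl
  · by_cases h' : p.val = j.val + 1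
    · refine ⟨j, { toFun := fun v => a j.castSucc * v
                   map_add' := fun v w => mul_add _ v w
                   map_smul' := fun r v => mul_smul_comm r _ v }, fun v => funext fun k => ?_⟩
      simp only [Fin.contractNth, Function.update_apply, Fin.ext_iff, Fin.val_castSucc,
        Fin.val_succ, LinearMap.coe_mk, AddHom.coe_mk]
      split_ifs with h1 h2 h3 h4 h5 <;> first | rfl | omega | skip
      all_goals
        have hk : k = j := Fin.ext (by omega)
        subst hk
        rfl
    · refine ⟨⟨p.val - 1, by omega⟩, LinearMap.id, fun v => funext fun k => ?_⟩
      simp only [Fin.contractNth, Function.update_apply, Fin.ext_iff, Fin.val_castSucc,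
        Fin.val_succ, LinearMap.id_apply]
      split_ifs <;> first | rfl | omega

/-- `(a₀, …, aₙ) ↦ a₀ ⊗ ⋯ ⊗ aⱼaⱼ₊₁ ⊗ ⋯ ⊗ aₙ`, as a multilinear map. -/
def faceMultilinear (n : ℕ) (j : Fin n) :
    MultilinearMap ℂ (fun _ : Fin (n + 1) => N) (⨂[ℂ]^n N) :=
  MultilinearMap.mk'
    (fun a => PiTensorProduct.tprod ℂ (Fin.contractNth j.castSucc (· * ·) a))
    (by
      intro a p v w
      obtain ⟨q, g, hg⟩ := contractNth_update N j a p
      rw [hg, hg, hg, map_add, MultilinearMap.map_update_add])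
    (by
      intro a p r v
      obtain ⟨q, g, hg⟩ := contractNth_update N j a p
      rw [hg, hg, map_smul, MultilinearMap.map_update_smul])

/-- The linear map `a₀ ⊗ ⋯ ⊗ aₙ ↦ a₀ ⊗ ⋯ ⊗ aⱼaⱼ₊₁ ⊗ ⋯ ⊗ aₙ`. -/
def face (n : ℕ) (j : Fin n) : (⨂[ℂ]^(n + 1) N) →ₗ[ℂ] (⨂[ℂ]^n N) :=
  PiTensorProduct.lift (faceMultilinear N n j)

/-- The differential
`a₀ ⊗ ⋯ ⊗ aₙ ↦ a₀a₁ ⊗ a₂ ⊗ ⋯ - a₀ ⊗ a₁a₂ ⊗ ⋯ + ⋯` from `(n+1)`-chains to `n`-chains. -/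
def d (n : ℕ) : (⨂[ℂ]^(n + 1) N) →ₗ[ℂ] (⨂[ℂ]^n N) :=
  ∑ j : Fin n, ((-1 : ℂ) ^ (j : ℕ)) • face N n j

/-- Closed `n`-chains. -/
def cycles : (n : ℕ) → Submodule ℂ (⨂[ℂ]^n N)
  | 0 => ⊤
  | n + 1 => LinearMap.ker (d N n)

/-- Exact `n`-chains. -/
def boundaries (n : ℕ) : Submodule ℂ (⨂[ℂ]^n N) := LinearMap.range (d N n)

/-- `Hoch_n`: closed `n`-chains modulo exact ones (every exact chain is closed, as `d ∘ d = 0`). -/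
abbrev Hoch (n : ℕ) : Type _ := cycles N n ⧸ (boundaries N n).submoduleOf (cycles N n)

/-! The Barr--Gerstenhaber--Schack decomposition. -/

/-- The number of descents `σ(i) > σ(i+1)` of a permutation. -/
def descents {n : ℕ} (σ : Equiv.Perm (Fin n)) : ℕ :=
  Fintype.card {i : Fin n // ∃ h : (i : ℕ) + 1 < n, σ ⟨(i : ℕ) + 1, h⟩ < σ i}

/-- The coefficient of `x ^ k` in `(x - m) (x - m + 1) ⋯ (x - m + n - 1)`. -/
def garsiaCoeff (n m k : ℕ) : ℂ :=
  (∏ i ∈ Finset.range n,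
    (Polynomial.X - Polynomial.C (m : ℂ) + Polynomial.C (i : ℂ))).coeff k

/-- The idempotent `e_n(k)` acting on `n`-chains, given by Garsia's generating function
`∑ₖ xᵏ e_n(k) = (1/n!) ∑_σ (x - d_σ) (x - d_σ + 1) ⋯ (x - d_σ + n - 1) sgn(σ) σ`.
A permutation `σ` moves the factor in position `i` to position `σ i`. -/
def e (n k : ℕ) : (⨂[ℂ]^n N) →ₗ[ℂ] (⨂[ℂ]^n N) :=
  ((Nat.factorial n : ℂ)⁻¹) • ∑ σ : Equiv.Perm (Fin n),
    (garsiaCoeff n (descents σ) k * ((Equiv.Perm.sign σ : ℤ) : ℂ)) •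
      (PiTensorProduct.reindex ℂ (fun _ : Fin n => N) σ).toLinearMap

/-- The component `C_{n,k} = e_n(k) C_n` of the space of `n`-chains. -/
def comp (n k : ℕ) : Submodule ℂ (⨂[ℂ]^n N) := LinearMap.range (e N n k)

/-- Closed chains in `C_{n,k}`. -/
def cyclesComp (n k : ℕ) : Submodule ℂ (⨂[ℂ]^n N) := cycles N n ⊓ comp N n k

/-- The image `d C_{n+1,k}` of the differential on the `k`-th component. -/
def boundariesComp (n k : ℕ) : Submodule ℂ (⨂[ℂ]^n N) := (comp N (n + 1) k).map (d N n)

/-- `H_{n,k}`: the homology in degree `n` of the `k`-th component `C_{•,k}`, a subcomplex because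
`d ∘ e_{n+1}(k) = e_n(k) ∘ d`. -/
abbrev HComp (n k : ℕ) : Type _ :=
  cyclesComp N n k ⧸ (boundariesComp N n k).submoduleOf (cyclesComp N n k)

theorem boundariesComp_le (n k : ℕ) : boundariesComp N n k ≤ boundaries N n :=
  LinearMap.map_le_range

theorem cyclesComp_le (n k : ℕ) : cyclesComp N n k ≤ cycles N n := inf_le_left

/-- The map `H_{n,k} → Hoch_n` induced by the inclusion of chains. -/
def toHoch (n k : ℕ) : HComp N n k →ₗ[ℂ] Hoch N n :=
  Submodule.mapQ _ _ (Submodule.inclusion (cyclesComp_le N n k))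
    (fun _ hz => boundariesComp_le N n k hz)

/-- The class in `Hoch_n` of a closed chain. -/
def hochClass (n : ℕ) (z : ⨂[ℂ]^n N) (hz : z ∈ cycles N n) : Hoch N n :=
  Submodule.Quotient.mk ⟨z, hz⟩

/-- The class in `H_{n,k}` of a closed chain of `C_{n,k}`. -/
def compClass (n k : ℕ) (z : ⨂[ℂ]^n N) (hz : z ∈ cyclesComp N n k) : HComp N n k :=
  Submodule.Quotient.mk ⟨z, hz⟩

/-- `c ⊗ a` for an `n`-chain `c` and an element `a`. -/
def snoc {n : ℕ} (c : ⨂[ℂ]^n N) (a : N) : ⨂[ℂ]^(n + 1) N :=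
  TensorPower.mulEquiv (c ⊗ₜ[ℂ] (PiTensorProduct.tprod ℂ (fun _ : Fin 1 => a)))

/-- The `2 × 2` matrices `M_n`, depending on the parity of `n`. -/
def M (x r : Fin 2 → N) (n : ℕ) : Matrix (Fin 2) (Fin 2) N :=
  if Odd n then !![r 0, -x 1; r 1, x 0] else !![x 0, x 1; -r 1, r 0]

/-- The rows of chains `P¹ = (x₁, x₂)`, `Pⁿ⁺¹ = Pⁿ ⊗ M_n` (the value at `0` is not used). -/
def P (x r : Fin 2 → N) : (n : ℕ) → Fin 2 → ⨂[ℂ]^n N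
  | 0 => 0
  | 1 => fun j => PiTensorProduct.tprod ℂ (fun _ : Fin 1 => x j)
  | n + 2 => fun j => ∑ i : Fin 2, snoc N (P x r (n + 1) i) (M N x r (n + 1) i j)

end BarComplex

section Curve

/-- The polynomials in two variables without constant term. -/
def maxIdeal : Ideal (MvPolynomial (Fin 2) ℂ) :=
  Ideal.span {MvPolynomial.X 0, MvPolynomial.X 1}

/-- The coordinate algebra `ℂ[x₁, x₂] / (R)`. -/
abbrev CoordRing (R : MvPolynomial (Fin 2) ℂ) : Type :=
  MvPolynomial (Fin 2) ℂ ⧸ Ideal.span {R}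

/-- The non-unital subalgebra `A₊` of positive degree: the classes of polynomials
without constant term. -/
def Aplus (R : MvPolynomial (Fin 2) ℂ) : NonUnitalSubalgebra ℂ (CoordRing R) :=
  { (maxIdeal.map (Ideal.Quotient.mk (Ideal.span {R}))).restrictScalars ℂ with
    mul_mem' := fun {_ _} _ hb =>
      (maxIdeal.map (Ideal.Quotient.mk (Ideal.span {R}))).mul_mem_left _ hb }

/-- The class in `A₊` of a polynomial without constant term. -/
def cl (R : MvPolynomial (Fin 2) ℂ) (f : maxIdeal) : Aplus R :=
  ⟨Ideal.Quotient.mk (Ideal.span {R}) f, Ideal.mem_map_of_mem _ f.2⟩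

/-- The coordinates, as polynomials without constant term. -/
def coord (i : Fin 2) : maxIdeal :=
  ⟨MvPolynomial.X i, Ideal.subset_span (by fin_cases i <;> simp)⟩

/-- The two chains `Pⁿ` of the curve `R = 0`, where `R = x₁R₁ + x₂R₂`. -/
def curveP (R : MvPolynomial (Fin 2) ℂ) (S : Fin 2 → maxIdeal) (n : ℕ) :
    Fin 2 → ⨂[ℂ]^n (Aplus R) :=
  P (Aplus R) (fun i => cl R (coord i)) (fun i => cl R (S i)) n

end Curve

end PlaneCurve

end

/-! Write `ψ^M` for `adams N (Fin M) n`: cut a word into `M` consecutive, possibly empty, blocks and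
add up all their shuffles with signs. Counting the cuts that lead to a given permutation turns
Garsia's generating function into `ψ^M = ∑ M^k e_n(k)` (`sum_pow_smul_e`). Hence `e_n(k)` projects
onto the eigenspace of eigenvalue `M^k`: multiplicativity of `ψ` in `M` gives orthogonal idempotents
(`e_comp_e`), and `d ψ^M = ψ^M d` (`d_comp_adams`) gives `d e = e d`. Each `C_{•,k}` is therefore a
direct summand of the complex, and it remains to compute `Hoch_n` and the eigenvalues of `ψ^M` on
it.

Upper bound. Up to a shift, the complex is the bar complex of `A₊` with coefficients in the module
`A₊`. That module has a resolution by free modules of rank two, with differentials from the matrix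
factorization `M_n M_{n+1} = R`; it is exact because `R` is a nonzero element of a domain. With free
coefficients the bar complex has only the constants as homology, and a staircase chase gives a
surjection `ℂ² → Hoch_n` (`finite_hoch_and_finrank_le`).

Lower bound. Lift `A` linearly to polynomials. The failure of the lift to be multiplicative, divided
by `R` and evaluated at the origin, is a symmetric form `β` with `β(ab,c) = β(a,bc)` and `∑ β(xᵢ,Rᵢ)
= 1`. Contracting the last two factors with `β` is a chain map taking `P^{n+2}` to `P^n`. The linear
coefficients, well defined and zero on products because `R` has neither constant nor linear terms,
settle degrees one and two (`eq_zero_of_sum_mem`).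

Eigenvalues. Contracting any adjacent pair of factors of `P^{n+2}` gives `P^n`, so contraction
intertwines the operations `ψ^M` on the rows up to a factor `M` (`contractLast_adams_row`): two
degrees up, the exponent grows by one. It is 1 on `P¹`, 2 on the antisymmetric chain `P²₂`, and 1 on
`P²₁` modulo `P²₂`. So `ψ^M` is `M^k` in degree `2k-1` and has eigenvalues `M^k`, `M^{k+1}` in
degree `2k`. -/

noncomputable section

namespace PlaneCurve

/-! ### Stable sorting permutations of colourings and their signs -/

section SortingPermutations

open Equiv

theorem perm_apply_inv {ι : Type*} (s : Perm ι) (x : ι) : s (s⁻¹ x) = x := s.apply_symm_apply x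

theorem perm_inv_apply {ι : Type*} (s : Perm ι) (x : ι) : s⁻¹ (s x) = x := s.symm_apply_apply x

theorem predAbove_succ_succAbove {n : ℕ} (j x : Fin n) :
    Fin.predAbove j (j.succ.succAbove x) = x := by
  rcases le_or_gt x j with h | h
  · rw [Fin.succAbove_of_castSucc_lt _ _ (Fin.castSucc_lt_succ_iff.2 h),
      Fin.predAbove_castSucc_of_le _ _ h]
  · rw [Fin.succAbove_of_le_castSucc _ _ (Fin.succ_le_castSucc_iff.2 h),
      Fin.predAbove_succ_of_le _ _ h.le]

/-- Extend a permutation of `Fin n` to `Fin (n + 1)` by sending `i` to `j`. -/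
def insertPerm {n : ℕ} (i j : Fin (n + 1)) (s : Perm (Fin n)) : Perm (Fin (n + 1)) :=
  (Fin.cycleRange j)⁻¹ * Perm.decomposeFin.symm (0, s) * Fin.cycleRange i

@[simp] theorem insertPerm_self {n : ℕ} (i j : Fin (n + 1)) (s : Perm (Fin n)) :
    insertPerm i j s i = j := by
  simp [insertPerm, Perm.mul_apply, Perm.inv_def]

@[simp] theorem insertPerm_succAbove {n : ℕ} (i j : Fin (n + 1)) (s : Perm (Fin n)) (x : Fin n) :
    insertPerm i j s (i.succAbove x) = j.succAbove (s x) := by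
  simp [insertPerm, Perm.mul_apply, Perm.inv_def]

@[simp] theorem insertPerm_inv_self {n : ℕ} (i j : Fin (n + 1)) (s : Perm (Fin n)) :
    (insertPerm i j s)⁻¹ j = i := by
  rw [Perm.inv_eq_iff_eq, insertPerm_self]

@[simp] theorem insertPerm_inv_succAbove {n : ℕ} (i j : Fin (n + 1)) (s : Perm (Fin n))
    (x : Fin n) : (insertPerm i j s)⁻¹ (j.succAbove x) = i.succAbove (s⁻¹ x) := by
  rw [Perm.inv_eq_iff_eq, insertPerm_succAbove, perm_apply_inv]

theorem sign_insertPerm {n : ℕ} (i j : Fin (n + 1)) (s : Perm (Fin n)) :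
    Perm.sign (insertPerm i j s) = (-1) ^ ((i : ℕ) + j) * Perm.sign s := by
  simp only [insertPerm, Perm.sign_mul, Perm.sign_inv, Fin.sign_cycleRange,
    Perm.decomposeFin.symm_sign, if_true, one_mul, pow_add]
  rw [mul_comm, ← mul_assoc]

variable {α : Type*} [LinearOrder α]

theorem sort_spec {n : ℕ} (c : Fin n → α) {i j : Fin n} (hij : i < j)
    (h : c (Tuple.sort c i) = c (Tuple.sort c j)) : Tuple.sort c i < Tuple.sort c j :=
  (Tuple.eq_sort_iff.1 (rfl : Tuple.sort c = Tuple.sort c)).2 i j hij h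

/-- Exchanging two adjacent entries of different colours. -/
theorem sort_comp_swap {n : ℕ} (c : Fin (n + 1) → α) (j : Fin n) (h : c j.castSucc ≠ c j.succ) :
    Tuple.sort (c ∘ swap j.castSucc j.succ) = swap j.castSucc j.succ * Tuple.sort c := by
  symm
  rw [Tuple.eq_sort_iff]
  refine ⟨?_, fun x y hxy he => ?_⟩
  · have : (c ∘ swap j.castSucc j.succ) ∘ (swap j.castSucc j.succ * Tuple.sort c : Perm _)
        = c ∘ Tuple.sort c := by
      funext x; simp
    rw [this]
    exact Tuple.monotone_sort c
  · simp only [Perm.mul_apply, Function.comp_apply, swap_apply_self] at he ⊢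
    have hlt := sort_spec c hxy he
    generalize Tuple.sort c x = p at he hlt ⊢
    generalize Tuple.sort c y = q at he hlt ⊢
    -- The transposition reverses the order of `p < q` only when they are exactly the exchanged
    -- pair, whose colours differ.
    have key : ¬ (p = j.castSucc ∧ q = j.succ) := by
      rintro ⟨rfl, rfl⟩; exact h he
    simp only [swap_apply_def, Fin.ext_iff, Fin.lt_def, Fin.val_castSucc, Fin.val_succ] at *
    split_ifs <;> (try simp only [Fin.val_castSucc, Fin.val_succ]) <;> omega

/-- Duplicating the entry in position `j`. -/
theorem sort_comp_predAbove {n : ℕ} (c : Fin n → α) (i j : Fin n) (h : Tuple.sort c i = j) :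
    Tuple.sort (c ∘ Fin.predAbove j) = insertPerm i.succ j.succ (Tuple.sort c) := by
  have hp : ∀ x, Fin.predAbove j (insertPerm i.succ j.succ (Tuple.sort c) x) =
      Tuple.sort c (Fin.predAbove i x) := by
    intro x
    obtain rfl | ⟨y, rfl⟩ := Fin.eq_self_or_eq_succAbove (i.succ) x
    · simp [h]
    · simp [predAbove_succ_succAbove]
  symm
  rw [Tuple.eq_sort_iff]
  refine ⟨?_, fun x y hxy he => ?_⟩
  · have : (c ∘ Fin.predAbove j) ∘ (insertPerm i.succ j.succ (Tuple.sort c)) =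
        (c ∘ Tuple.sort c) ∘ Fin.predAbove i := by
      funext x; simp [hp]
    rw [this]
    exact (Tuple.monotone_sort c).comp (Fin.predAbove_right_monotone i)
  · simp only [Function.comp_apply, hp] at he
    rcases (Fin.predAbove_right_monotone i hxy.le).lt_or_eq with hlt | heq
    · have := sort_spec c hlt he
      rw [← hp, ← hp] at this
      exact lt_of_not_ge fun hge => absurd (Fin.predAbove_right_monotone j hge) (not_le.2 this)
    · have hx : x = i.castSucc ∧ y = i.succ := by
        simp only [Fin.predAbove, Fin.lt_def, Fin.ext_iff, Fin.val_castSucc, Fin.val_succ] at *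
        split_ifs at heq <;> simp only [Fin.val_pred, Fin.coe_castPred] at heq <;> omega
      obtain ⟨rfl, rfl⟩ := hx
      have : i.castSucc = i.succ.succAbove i := by simp
      rw [insertPerm_self, this, insertPerm_succAbove, h]
      simp

/-- Removing the last entry. -/
theorem sort_eq_insertPerm_last {n : ℕ} (c : Fin (n + 1) → α) (i : Fin (n + 1))
    (h : Tuple.sort c i = Fin.last n) :
    Tuple.sort c = insertPerm i (Fin.last n) (Tuple.sort (c ∘ Fin.castSucc)) := by
  -- the permutation left after removing the last entry
  obtain ⟨s, hs⟩ : ∃ s : Perm (Fin n), Tuple.sort c = insertPerm i (Fin.last n) s := by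
    have hne : ∀ x, Tuple.sort c (i.succAbove x) ≠ Fin.last n := fun x hx =>
      Fin.succAbove_ne i x ((Tuple.sort c).injective (hx.trans h.symm))
    let f : Fin n → Fin n := fun x => (Tuple.sort c (i.succAbove x)).castPred (hne x)
    have hf : Function.Injective f := fun x y hxy => by
      have := Fin.castPred_inj.1 hxy
      exact Fin.succAbove_right_injective ((Tuple.sort c).injective this)
    refine ⟨Equiv.ofBijective f (Finite.injective_iff_bijective.1 hf), Equiv.ext fun x => ?_⟩
    obtain rfl | ⟨y, rfl⟩ := Fin.eq_self_or_eq_succAbove (i) x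
    · simp [h]
    · simp [f]
  rw [hs]
  congr 1
  rw [Tuple.eq_sort_iff]
  have hc : ∀ x, (s x).castSucc = Tuple.sort c (i.succAbove x) := fun x => by simp [hs]
  refine ⟨?_, fun x y hxy he => ?_⟩
  · have : (c ∘ Fin.castSucc) ∘ s = (c ∘ Tuple.sort c) ∘ i.succAbove := by
      funext x; simp [hc]
    rw [this]
    exact (Tuple.monotone_sort c).comp (Fin.strictMono_succAbove i).monotone
  · have := sort_spec c (Fin.strictMono_succAbove i hxy) (by simpa [hc] using he)
    rwa [← hc, ← hc, Fin.castSucc_lt_castSucc_iff] at this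

/-- The permutation sorting first by a colouring of the sorted tuple, then by a colouring. -/
theorem sort_mul_sort {β γ : Type*} [LinearOrder β] [LinearOrder γ] {n : ℕ} (c : Fin n → α)
    (c' : Fin n → β) (f : β → α → γ)
    (hf : ∀ b a b' a', f b a < f b' a' ↔ b < b' ∨ (b = b' ∧ a < a')) :
    Tuple.sort c * Tuple.sort c' = Tuple.sort fun p => f (c' ((Tuple.sort c)⁻¹ p)) (c p) := by
  have hinj : ∀ b a b' a', f b a = f b' a' → b = b' ∧ a = a' := by
    intro b a b' a' h
    have h1 := (hf b a b' a').not.1 h.not_lt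
    have h2 := (hf b' a' b a).not.1 h.symm.not_lt
    push Not at h1 h2
    have hb : b = b' := le_antisymm h2.1 h1.1
    exact ⟨hb, le_antisymm (h2.2 hb.symm) (h1.2 hb)⟩
  rw [Tuple.eq_sort_iff]
  refine ⟨monotone_iff_forall_lt.2 fun x y hxy => ?_, fun x y hxy he => ?_⟩
  · simp only [Function.comp_apply, Perm.mul_apply]
    have hm : c' (Tuple.sort c' x) ≤ c' (Tuple.sort c' y) := Tuple.monotone_sort c' hxy.le
    simp only [perm_inv_apply]
    rcases hm.lt_or_eq with hlt | heq
    · exact ((hf _ _ _ _).2 (Or.inl hlt)).le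
    · have h1 := sort_spec c' hxy heq
      have h2 := Tuple.monotone_sort c h1.le
      refine le_of_not_gt fun hgt => ?_
      rcases (hf _ _ _ _).1 hgt with h3 | h3
      · exact h3.ne heq.symm
      · exact absurd h3.2 (not_lt.2 h2)
  · simp only [Perm.mul_apply, perm_inv_apply] at he ⊢
    obtain ⟨h1, h2⟩ := hinj _ _ _ _ he
    exact sort_spec c (sort_spec c' hxy h1) h2

variable [Fintype α] {V : Type*} [AddCommGroup V] [Module ℂ V]

/-- The sign of the sorting permutation, as a scalar. -/
def sgn {n : ℕ} (s : Perm (Fin n)) : ℂ := ((Perm.sign s : ℤ) : ℂ)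

theorem sgn_mul {n : ℕ} (s t : Perm (Fin n)) : sgn (s * t) = sgn s * sgn t := by
  simp [sgn]

theorem sgn_insertPerm {n : ℕ} (i j : Fin (n + 1)) (s : Perm (Fin n)) :
    sgn (insertPerm i j s) = (-1) ^ ((i : ℕ) + j) * sgn s := by
  simp [sgn, sign_insertPerm]

/-- If `F` does not see the exchange of positions `j` and `j + 1`, then in the signed sum of `F`
over all sorting permutations only the colourings with equal colours there survive. -/
theorem sum_sgn_sort_eq {n : ℕ} (j : Fin n) (F : Perm (Fin (n + 1)) → V)
    (hF : ∀ s, F (swap j.castSucc j.succ * s) = F s) :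
    ∑ c : Fin (n + 1) → α, sgn (Tuple.sort c) • F (Tuple.sort c) =
      ∑ c : Fin n → α, ((-1) ^ (((Tuple.sort c)⁻¹ j : ℕ) + j) * sgn (Tuple.sort c)) •
        F (insertPerm ((Tuple.sort c)⁻¹ j).succ j.succ (Tuple.sort c)) := by
  classical
  have hsw : ∀ c : Fin (n + 1) → α, (c ∘ swap j.castSucc j.succ) ∘ swap j.castSucc j.succ = c :=
    fun c => by funext x; simp
  rw [← Finset.sum_filter_add_sum_filter_not Finset.univ
    (fun c : Fin (n + 1) → α => c j.castSucc = c j.succ)]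
  -- Exchanging the two colours multiplies the sorting permutation by the transposition: the sign
  -- flips and `F` does not change, so these terms cancel in pairs.
  have hz : ∑ c : Fin (n + 1) → α with ¬ c j.castSucc = c j.succ,
      sgn (Tuple.sort c) • F (Tuple.sort c) = 0 := by
    refine Finset.sum_involution (fun c _ => c ∘ swap j.castSucc j.succ) ?_ ?_ ?_ ?_
    · intro c hc
      rw [sort_comp_swap c j (Finset.mem_filter.1 hc).2, hF, sgn_mul]
      have : sgn (swap j.castSucc j.succ) = -1 := by
        rw [sgn, Perm.sign_swap (by simp [Fin.ext_iff])]; simp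
      rw [this]; simp
    · intro c hc _ h
      refine (Finset.mem_filter.1 hc).2 ?_
      have := congrFun h j.succ
      simpa using this
    · intro c hc
      have := (Finset.mem_filter.1 hc).2
      simpa using fun h => this (Eq.symm h)
    · intro c _
      exact hsw c
  rw [hz, add_zero]
  -- A colouring with equal colours at `j` and `j + 1` is a colouring of `n` positions with entry
  -- `j` duplicated.
  refine Finset.sum_bij' (fun c _ => c ∘ j.succ.succAbove) (fun c _ => c ∘ Fin.predAbove j)
    (by simp) ?_ ?_ ?_ ?_
  · intro c _; simp
  · intro c hc
    have := (Finset.mem_filter.1 hc).2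
    funext x
    obtain rfl | ⟨y, rfl⟩ := Fin.eq_self_or_eq_succAbove (j.succ) x
    · simpa using this
    · simp
  · intro c _
    funext x; simp [predAbove_succ_succAbove]
  · intro c hc
    obtain ⟨c, rfl⟩ : ∃ c' : Fin n → α, c = c' ∘ Fin.predAbove j := by
      refine ⟨c ∘ j.succ.succAbove, funext fun x => ?_⟩
      have := (Finset.mem_filter.1 hc).2
      obtain rfl | ⟨y, rfl⟩ := Fin.eq_self_or_eq_succAbove (j.succ) x
      · simpa using this.symm
      · simp
    have h1 : (c ∘ Fin.predAbove j) ∘ j.succ.succAbove = c := by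
      funext x; simp [predAbove_succ_succAbove]
    rw [h1, sort_comp_predAbove c ((Tuple.sort c)⁻¹ j) j (by simp), sgn_insertPerm]
    congr 2
    rw [Fin.val_succ, Fin.val_succ, show ∀ a b : ℕ, a + 1 + (b + 1) = a + b + 2 by intros; omega,
      pow_add]
    norm_num

end SortingPermutations

end PlaneCurve
end

noncomputable section

namespace PlaneCurve

/-! ### Colourings with a given sorting permutation, and Garsia's coefficients -/

section CountingColourings

open Equiv

/-- The hockey-stick identity; `t ≤ n` ensures that no terms are missing at the lower end. -/
theorem sum_range_choose_add (B t n : ℕ) (h : t ≤ n) :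
    ∑ v ∈ Finset.range B, (v + t).choose n = (B + t).choose (n + 1) := by
  induction B with
  | zero => simp [Nat.choose_eq_zero_of_lt (Nat.lt_succ_of_le h)]
  | succ B ih =>
    rw [Finset.sum_range_succ, ih, show B + 1 + t = (B + t) + 1 by omega, Nat.choose_succ_succ,
      add_comm]

/-- The number of tuples which increase weakly, strictly at the places in `D`, with last
entry below `B`. -/
theorem card_increasing (m : ℕ) : ∀ (D : Fin m → Prop) [DecidablePred D] (M B : ℕ), B ≤ M →
    Fintype.card {g : Fin (m + 1) → Fin M // (∀ i : Fin m, g i.castSucc ≤ g i.succ ∧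
      (D i → g i.castSucc < g i.succ)) ∧ (g (Fin.last m) : ℕ) < B} =
      (B + m - (Finset.univ.filter D).card).choose (m + 1) := by
  induction m with
  | zero =>
    intro D _ M B hB
    have e : {g : Fin (0 + 1) → Fin M // (∀ i : Fin 0, g i.castSucc ≤ g i.succ ∧
      (D i → g i.castSucc < g i.succ)) ∧ (g (Fin.last 0) : ℕ) < B} ≃ Fin B :=
      { toFun := fun g => ⟨g.1 0, g.2.2⟩
        invFun := fun v => ⟨fun _ => ⟨v, v.2.trans_le hB⟩, fun i => i.elim0, v.2⟩
        left_inv := fun g => Subtype.ext (funext fun i => by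
          have : i = 0 := Fin.ext (by omega)
          subst this; rfl)
        right_inv := fun v => rfl }
    rw [Fintype.card_congr e]
    simp
  | succ m ih =>
    intro D _ M B hB
    set D' : Fin m → Prop := fun i => D i.castSucc with hD'
    -- With last entry `v`, the entry before it is below `v + 1 - δ`: at most `v`, or less than `v`
    -- where strictness is required.
    set δ : ℕ := if D (Fin.last m) then 1 else 0 with hδ
    have hcard : (Finset.univ.filter D).card = (Finset.univ.filter D').card + δ := by
      rw [Finset.card_filter, Fin.sum_univ_castSucc, ← Finset.card_filter]
    have hle : (Finset.univ.filter D').card ≤ m := by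
      simpa using Finset.card_filter_le Finset.univ D'
    have e : {g : Fin (m + 1 + 1) → Fin M // (∀ i : Fin (m + 1), g i.castSucc ≤ g i.succ ∧
      (D i → g i.castSucc < g i.succ)) ∧ (g (Fin.last (m + 1)) : ℕ) < B} ≃
      Σ v : Fin B, {g : Fin (m + 1) → Fin M // (∀ i : Fin m, g i.castSucc ≤ g i.succ ∧
      (D' i → g i.castSucc < g i.succ)) ∧ (g (Fin.last m) : ℕ) < v + 1 - δ} :=
      { toFun := fun g => ⟨⟨g.1 (Fin.last _), g.2.2⟩, fun i => g.1 i.castSucc, fun i => by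
            simpa using g.2.1 i.castSucc, by
            have h := g.2.1 (Fin.last m)
            rw [show (Fin.last m).succ = Fin.last (m + 1) from rfl] at h
            simp only [Fin.le_def, Fin.lt_def] at h
            simp only [hδ]
            split_ifs with hd
            · have := h.2 hd; omega
            · omega⟩
        invFun := fun p => ⟨Fin.snoc (α := fun _ => Fin M) p.2.1 ⟨p.1, p.1.2.trans_le hB⟩, by
          refine ⟨fun i => ?_, by simp⟩
          induction i using Fin.lastCases with
          | last =>
            have h := p.2.2.2
            simp only [Fin.succ_last, Fin.snoc_last, Fin.snoc_castSucc, Fin.le_def, Fin.lt_def]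
            simp only [hδ] at h
            split_ifs at h with hd
            · exact ⟨by omega, fun _ => by omega⟩
            · exact ⟨by omega, fun h' => absurd h' hd⟩
          | cast i =>
            rw [Fin.succ_castSucc]
            simpa only [Fin.snoc_castSucc] using p.2.2.1 i⟩
        left_inv := fun g => by
          apply Subtype.ext
          funext i
          induction i using Fin.lastCases <;> simp
        right_inv := fun p => by
          rcases p with ⟨v, g, hg⟩
          exact Sigma.subtype_ext (by simp) (by simp) }
    rw [Fintype.card_congr e, Fintype.card_sigma]
    have : ∀ v : Fin B, Fintype.card {g : Fin (m + 1) → Fin M //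
        (∀ i : Fin m, g i.castSucc ≤ g i.succ ∧ (D' i → g i.castSucc < g i.succ)) ∧
        (g (Fin.last m) : ℕ) < v + 1 - δ} =
        (v + (m + 1 - (Finset.univ.filter D).card)).choose (m + 1) := by
      intro v
      rw [ih D' M _ (by omega), hcard]
      congr 1
      have : δ ≤ 1 := by simp only [hδ]; split_ifs <;> simp
      omega
    rw [Finset.sum_congr rfl fun v _ => this v,
      Fin.sum_univ_eq_sum_range (fun v => (v + (m + 1 - (Finset.univ.filter D).card)).choose (m+1)),
      sum_range_choose_add _ _ _ (Nat.sub_le _ _)]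
    congr 1
    have : δ ≤ 1 := by simp only [hδ]; split_ifs <;> simp
    omega

theorem descents_succ {m : ℕ} (σ : Perm (Fin (m + 1))) :
    descents σ = (Finset.univ.filter fun i : Fin m => σ i.succ < σ i.castSucc).card := by
  rw [descents, ← Fintype.card_subtype]
  refine Fintype.card_congr
    { toFun := fun i => ⟨⟨i.1, by obtain ⟨h, _⟩ := i.2; omega⟩, by obtain ⟨h, h'⟩ := i.2; exact h'⟩
      invFun := fun i => ⟨i.1.castSucc, by simp, i.2⟩
      left_inv := fun i => rfl
      right_inv := fun i => rfl }

theorem descents_le {m : ℕ} (σ : Perm (Fin (m + 1))) : descents σ ≤ m := by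
  rw [descents_succ]
  simpa using Finset.card_filter_le Finset.univ fun i : Fin m => σ i.succ < σ i.castSucc

/-- Because the sort is stable, the left side says that `i ↦ (g i, σ i)` is strictly increasing for
the lexicographic order, and this can be tested on neighbours. -/
theorem sort_eq_iff {α : Type*} [LinearOrder α] {m : ℕ} (g : Fin (m + 1) → α)
    (σ : Perm (Fin (m + 1))) : Tuple.sort (g ∘ ⇑σ⁻¹) = σ ↔
      ∀ i : Fin m, g i.castSucc ≤ g i.succ ∧ (σ i.succ < σ i.castSucc →
        g i.castSucc < g i.succ) := by
  have h1 : (g ∘ ⇑σ⁻¹) ∘ σ = g := by funext x; simp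
  rw [eq_comm, Tuple.eq_sort_iff, h1]
  have hs : (Monotone g ∧ ∀ i j, i < j → (g ∘ ⇑σ⁻¹) (σ i) = (g ∘ ⇑σ⁻¹) (σ j) → σ i < σ j) ↔
      StrictMono fun i => toLex (g i, σ i) := by
    simp only [Function.comp_apply, perm_inv_apply]
    constructor
    · rintro ⟨hm, ht⟩ i j hij
      rw [Prod.Lex.toLex_lt_toLex]
      rcases (hm hij.le).lt_or_eq with h | h
      · exact Or.inl h
      · exact Or.inr ⟨h, ht i j hij h⟩
    · intro h
      refine ⟨monotone_iff_forall_lt.2 fun i j hij => ?_, fun i j hij he => ?_⟩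
      · rcases Prod.Lex.toLex_lt_toLex.1 (h hij) with h | h
        · exact h.le
        · exact h.1.le
      · rcases Prod.Lex.toLex_lt_toLex.1 (h hij) with h | h
        · exact absurd he h.ne
        · exact h.2
  rw [hs, Fin.strictMono_iff_lt_succ]
  refine forall_congr' fun i => ?_
  rw [Prod.Lex.toLex_lt_toLex]
  have hne : σ i.castSucc ≠ σ i.succ := fun h => by
    simpa [Fin.ext_iff] using σ.injective h
  constructor
  · rintro (h | h)
    · exact ⟨h.le, fun _ => h⟩
    · exact ⟨h.1.le, fun h' => absurd h' h.2.not_gt⟩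
  · rintro ⟨h1, h2⟩
    rcases h1.lt_or_eq with h | h
    · exact Or.inl h
    · exact Or.inr ⟨h, lt_of_le_of_ne (not_lt.1 fun h' => (h2 h').ne h) hne⟩

/-- Read along `σ`, such a colouring is a weakly increasing sequence that rises strictly at the
descents of `σ`. -/
theorem card_sort_eq (n M : ℕ) (σ : Perm (Fin n)) :
    (Finset.univ.filter fun c : Fin n → Fin M => Tuple.sort c = σ).card =
      (M + n - 1 - descents σ).choose n := by
  cases n with
  | zero =>
    rw [Nat.choose_zero_right, Finset.card_eq_one]
    exact ⟨Fin.elim0, by ext c; simp [Subsingleton.elim _ σ, eq_iff_true_of_subsingleton]⟩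
  | succ m =>
    rw [← Fintype.card_subtype, descents_succ]
    have := card_increasing m (fun i : Fin m => σ i.succ < σ i.castSucc) M M le_rfl
    rw [show M + (m + 1) - 1 = M + m by omega, ← this]
    refine Fintype.card_congr
      { toFun := fun c => ⟨c.1 ∘ σ, (sort_eq_iff (c.1 ∘ σ) σ).1 ((congrArg Tuple.sort
            (by funext x; simp)).trans c.2), Fin.is_lt _⟩
        invFun := fun g => ⟨g.1 ∘ ⇑σ⁻¹, (sort_eq_iff g.1 σ).2 g.2.1⟩
        left_inv := fun c => Subtype.ext (by funext x; simp)
        right_inv := fun g => Subtype.ext (by funext x; simp) }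

/-- The left side is Garsia's product evaluated at `x = M`, a rising factorial starting at `M -
d_σ`, which is `n!` times the binomial coefficient counting colourings. -/
theorem sum_pow_mul_garsiaCoeff (n M K : ℕ) (hK : n < K) (σ : Perm (Fin n)) :
    ∑ k ∈ Finset.range K, (M : ℂ) ^ k * garsiaCoeff n (descents σ) k =
      (n.factorial : ℂ) *
        (Finset.univ.filter fun c : Fin n → Fin M => Tuple.sort c = σ).card := by
  set p : Polynomial ℂ := ∏ i ∈ Finset.range n,
    (Polynomial.X - Polynomial.C ((descents σ : ℕ) : ℂ) + Polynomial.C (i : ℂ)) with hp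
  have hdeg : p.natDegree < K := by
    refine lt_of_le_of_lt ((Polynomial.natDegree_prod_le _ _).trans ?_) hK
    refine (Finset.sum_le_card_nsmul _ _ 1 fun i _ => ?_).trans (by simp)
    show Polynomial.natDegree _ ≤ 1
    compute_degree
  have h1 : ∑ k ∈ Finset.range K, (M : ℂ) ^ k * garsiaCoeff n (descents σ) k = p.eval (M : ℂ) := by
    rw [Polynomial.eval_eq_sum_range' hdeg]
    exact Finset.sum_congr rfl fun k _ => mul_comm _ _
  rw [h1, card_sort_eq, hp, Polynomial.eval_prod]
  simp only [Polynomial.eval_add, Polynomial.eval_sub, Polynomial.eval_X, Polynomial.eval_C]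
  rcases lt_or_ge (descents σ) M with h | h
  · obtain ⟨t, ht⟩ : ∃ t, M = descents σ + t := ⟨M - descents σ, by omega⟩
    rw [show M + n - 1 - descents σ = t + n - 1 by omega]
    have := Nat.ascFactorial_eq_factorial_mul_choose' t n
    rw [Nat.ascFactorial_eq_prod_range] at this
    rw [← Nat.cast_mul, ← this, Nat.cast_prod]
    refine Finset.prod_congr rfl fun i _ => ?_
    rw [ht]; push_cast; ring
  · cases n with
    | zero => simp
    | succ m =>
      have := descents_le σ
      rw [Nat.choose_eq_zero_of_lt (by omega), Nat.cast_zero, mul_zero]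
      -- With at least `M` descents no colouring exists, and the factor `x - d_σ + i` vanishes at `x
      -- = M` for this `i`.
      refine Finset.prod_eq_zero (i := descents σ - M) (Finset.mem_range.2 (by omega)) ?_
      rw [Nat.cast_sub h]; ring

theorem garsiaCoeff_eq_zero {n m k : ℕ} (h : n < k) : garsiaCoeff n m k = 0 := by
  refine Polynomial.coeff_eq_zero_of_natDegree_lt (lt_of_le_of_lt ?_ h)
  refine (Polynomial.natDegree_prod_le _ _).trans ?_
  refine (Finset.sum_le_card_nsmul _ _ 1 fun i _ => ?_).trans (by simp)
  show Polynomial.natDegree _ ≤ 1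
  compute_degree

end CountingColourings

end PlaneCurve
end

noncomputable section

set_option linter.unusedSectionVars false

namespace PlaneCurve

/-! ### Adams operations and the idempotents as their eigenprojections -/

section Adams

open Equiv PiTensorProduct

variable (N : Type*) [NonUnitalCommRing N] [Module ℂ N] [IsScalarTower ℂ N N]
  [SMulCommClass ℂ N N]

theorem linearMap_comp_sum {ι U V W : Type*} [AddCommGroup U] [AddCommGroup V] [AddCommGroup W]
    [Module ℂ U] [Module ℂ V] [Module ℂ W] (s : Finset ι) (f : ι → U →ₗ[ℂ] V) (g : V →ₗ[ℂ] W) :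
    g ∘ₗ ∑ i ∈ s, f i = ∑ i ∈ s, g ∘ₗ f i := by
  ext; simp

theorem linearMap_sum_comp {ι U V W : Type*} [AddCommGroup U] [AddCommGroup V] [AddCommGroup W]
    [Module ℂ U] [Module ℂ V] [Module ℂ W] (s : Finset ι) (f : U →ₗ[ℂ] V) (g : ι → V →ₗ[ℂ] W) :
    (∑ i ∈ s, g i) ∘ₗ f = ∑ i ∈ s, g i ∘ₗ f := by
  ext; simp

/-- A permutation acting on chains. -/
abbrev permute {n : ℕ} (s : Perm (Fin n)) : (⨂[ℂ]^n N) →ₗ[ℂ] (⨂[ℂ]^n N) :=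
  (PiTensorProduct.reindex ℂ (fun _ : Fin n => N) s).toLinearMap

theorem permute_tprod {n : ℕ} (s : Perm (Fin n)) (a : Fin n → N) :
    permute N s (tprod ℂ a) = tprod ℂ fun p => a (s⁻¹ p) :=
  PiTensorProduct.reindex_tprod _ _

theorem permute_comp {n : ℕ} (s t : Perm (Fin n)) :
    permute N s ∘ₗ permute N t = permute N (s * t) := by
  ext a
  simp only [LinearMap.compMultilinearMap_apply, LinearMap.comp_apply, permute_tprod]
  rw [mul_inv_rev]
  rfl

theorem permute_one (n : ℕ) : permute N (1 : Perm (Fin n)) = LinearMap.id := by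
  ext a
  simp only [LinearMap.compMultilinearMap_apply, permute_tprod, LinearMap.id_apply]
  rfl

/-- The Adams operation, summing over all colourings of the positions of a word. -/
def adams (α : Type*) [LinearOrder α] [Fintype α] (n : ℕ) : (⨂[ℂ]^n N) →ₗ[ℂ] (⨂[ℂ]^n N) :=
  ∑ c : Fin n → α, sgn (Tuple.sort c) • permute N (Tuple.sort c)

theorem adams_tprod (α : Type*) [LinearOrder α] [Fintype α] (n : ℕ) (a : Fin n → N) :
    adams N α n (tprod ℂ a) =
      ∑ c : Fin n → α, sgn (Tuple.sort c) • tprod ℂ fun p => a ((Tuple.sort c)⁻¹ p) := by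
  simp only [adams, LinearMap.sum_apply, LinearMap.smul_apply, permute_tprod]

theorem e_eq_zero {n k : ℕ} (h : n < k) : e N n k = 0 := by
  simp [e, garsiaCoeff_eq_zero h]

/-- Grouping colourings by their sorting permutation reduces this to `sum_pow_mul_garsiaCoeff`. Any
`K > n` may be used since `e N n k` vanishes for `k > n`. -/
theorem sum_pow_smul_e (n M K : ℕ) (hK : n < K) :
    ∑ k ∈ Finset.range K, (M : ℂ) ^ k • e N n k = adams N (Fin M) n := by
  have h1 : adams N (Fin M) n = ∑ σ : Perm (Fin n),
      ((Finset.univ.filter fun c : Fin n → Fin M => Tuple.sort c = σ).card : ℂ) •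
        (sgn σ • permute N σ) := by
    rw [adams, ← Finset.sum_fiberwise Finset.univ fun c : Fin n → Fin M => Tuple.sort c]
    refine Finset.sum_congr rfl fun σ _ => ?_
    rw [Finset.sum_congr rfl fun c hc => by rw [(Finset.mem_filter.1 hc).2], Finset.sum_const,
      Nat.cast_smul_eq_nsmul]
  rw [h1]
  simp only [e, Finset.smul_sum, smul_smul]
  rw [Finset.sum_comm]
  refine Finset.sum_congr rfl fun σ _ => ?_
  rw [← Finset.sum_smul]
  congr 1
  have h2 := sum_pow_mul_garsiaCoeff n M K hK σ
  have h3 : (n.factorial : ℂ) ≠ 0 := Nat.cast_ne_zero.2 n.factorial_ne_zero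
  calc _ = (n.factorial : ℂ)⁻¹ * (∑ k ∈ Finset.range K, (M : ℂ) ^ k *
        garsiaCoeff n (descents σ) k) * sgn σ := by
        rw [Finset.mul_sum, Finset.sum_mul]
        exact Finset.sum_congr rfl fun k _ => by rw [sgn]; ring
    _ = _ := by rw [h2]; field_simp

/-- Sorting by one colouring and then by another is sorting by pairs of colours in lexicographic
order (`sort_mul_sort`), and `Fin M' × Fin M` in that order is `Fin (M' * M)`. -/
theorem adams_comp_adams (M M' n : ℕ) :
    adams N (Fin M) n ∘ₗ adams N (Fin M') n = adams N (Fin (M' * M)) n := by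
  have h1 : adams N (Fin M) n ∘ₗ adams N (Fin M') n =
      ∑ c : Fin n → Fin M, ∑ c' : Fin n → Fin M',
        sgn (Tuple.sort c * Tuple.sort c') • permute N (Tuple.sort c * Tuple.sort c') := by
    simp only [adams, linearMap_sum_comp, linearMap_comp_sum, LinearMap.smul_comp,
      LinearMap.comp_smul, permute_comp, sgn_mul, mul_smul, Finset.smul_sum]
    rw [Finset.sum_comm]
    exact Finset.sum_congr rfl fun c _ => Finset.sum_congr rfl fun c' _ => smul_comm _ _ _
  rw [h1, ← Finset.sum_product', adams]
  have hf : ∀ (b : Fin M') (a : Fin M) (b' : Fin M') (a' : Fin M),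
      finProdFinEquiv (b, a) < finProdFinEquiv (b', a') ↔ b < b' ∨ (b = b' ∧ a < a') := by
    intro b a b' a'
    simp only [Fin.lt_def, finProdFinEquiv_apply_val, Fin.ext_iff]
    have ha := a.2
    have ha' := a'.2
    constructor
    · intro h
      rcases lt_trichotomy (b : ℕ) b' with h1 | h1 | h1
      · exact Or.inl h1
      · rw [h1] at h; exact Or.inr ⟨h1, by omega⟩
      · have := Nat.mul_le_mul_left M (Nat.succ_le_of_lt h1)
        rw [Nat.mul_succ] at this
        omega
    · rintro (h | ⟨h, h'⟩)
      · have := Nat.mul_le_mul_left M (Nat.succ_le_of_lt h)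
        rw [Nat.mul_succ] at this
        omega
      · rw [h]; omega
  -- For the inverse, the second component yields `c`; the first component must then be read along
  -- the sort of `c`.
  refine Finset.sum_bij' (fun p _ => fun x => finProdFinEquiv (p.2 ((Tuple.sort p.1)⁻¹ x), p.1 x))
    (fun c _ => (fun x => (finProdFinEquiv.symm (c x)).2, fun x => (finProdFinEquiv.symm
      (c (Tuple.sort (fun x => (finProdFinEquiv.symm (c x)).2) x))).1))
    (by simp) (by simp) ?_ ?_ ?_
  · rintro ⟨c, c'⟩ _
    simp
  · intro c _
    simp only [perm_apply_inv, Prod.mk.eta, Equiv.apply_symm_apply]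
  · rintro ⟨c, c'⟩ _
    rw [sort_mul_sort c c' (fun b a => finProdFinEquiv (b, a)) hf]

theorem adams_one (n : ℕ) : adams N (Fin 1) n = LinearMap.id := by
  have : ∀ c : Fin n → Fin 1, Tuple.sort c = 1 := fun c =>
    Tuple.sort_eq_refl_iff_monotone.2 fun _ _ _ => (Subsingleton.elim _ _).le
  simp [adams, this, sgn, permute_one]

/-- A polynomial with vector coefficients vanishing at all natural numbers is zero. -/
theorem eq_zero_of_sum_pow_smul {V : Type*} [AddCommGroup V] [Module ℂ V] (K : ℕ) (v : ℕ → V)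
    (h : ∀ M : ℕ, ∑ k ∈ Finset.range K, (M : ℂ) ^ k • v k = 0) : ∀ k < K, v k = 0 := by
  intro k hk
  -- Linear functionals reduce the claim to a scalar polynomial with infinitely many roots.
  rw [← Module.forall_dual_apply_eq_zero_iff ℂ]
  intro f
  set p : Polynomial ℂ := ∑ k ∈ Finset.range K, Polynomial.monomial k (f (v k)) with hp
  have h0 : p = 0 := by
    refine Polynomial.eq_zero_of_infinite_isRoot _ ((Set.infinite_range_of_injective
      (Nat.cast_injective (R := ℂ))).mono ?_)
    rintro _ ⟨M, rfl⟩
    have := congrArg f (h M)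
    simp only [map_sum, map_smul, smul_eq_mul, map_zero] at this
    simp only [Set.mem_ofPred_eq, Polynomial.IsRoot.def, hp, Polynomial.eval_finsetSum,
      Polynomial.eval_monomial]
    rw [← this]
    exact Finset.sum_congr rfl fun _ _ => mul_comm _ _
  have := congrArg (fun q => Polynomial.coeff q k) h0
  simpa [hp, Polynomial.finsetSum_coeff, Polynomial.coeff_monomial, hk] using this

theorem eq_of_sum_pow_smul {V : Type*} [AddCommGroup V] [Module ℂ V] (K : ℕ) (v w : ℕ → V)
    (h : ∀ M : ℕ, ∑ k ∈ Finset.range K, (M : ℂ) ^ k • v k =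
      ∑ k ∈ Finset.range K, (M : ℂ) ^ k • w k) : ∀ k < K, v k = w k := by
  intro k hk
  refine sub_eq_zero.1 (eq_zero_of_sum_pow_smul K (fun k => v k - w k) (fun M => ?_) k hk)
  simp only [smul_sub, Finset.sum_sub_distrib, h, sub_self]

/-- In `ψ^{M'} ψ^M = ψ^{MM'}` the coefficient of `M'^j` gives `e_j ψ^M = M^j e_j`; then the
coefficient of `M^k` is compared. -/
theorem e_comp_e (n j k : ℕ) : e N n j ∘ₗ e N n k = if j = k then e N n k else 0 := by
  by_cases hj : n < j
  · rw [e_eq_zero N hj, LinearMap.zero_comp]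
    split_ifs with h
    · rw [← h, e_eq_zero N hj]
    · rfl
  by_cases hk : n < k
  · rw [e_eq_zero N hk, LinearMap.comp_zero]; simp
  have key : ∀ M : ℕ, ∀ j < n + 1, e N n j ∘ₗ adams N (Fin M) n = (M : ℂ) ^ j • e N n j := by
    intro M
    refine eq_of_sum_pow_smul (n + 1) _ _ fun M' => ?_
    have h1 := adams_comp_adams N M' M n
    rw [← sum_pow_smul_e N n M' (n + 1) (Nat.lt_succ_self n),
      ← sum_pow_smul_e N n (M * M') (n + 1) (Nat.lt_succ_self n), linearMap_sum_comp] at h1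
    simp only [LinearMap.smul_comp] at h1
    rw [h1]
    refine Finset.sum_congr rfl fun k _ => ?_
    rw [smul_smul]; push_cast; rw [mul_pow, mul_comm]
  refine eq_of_sum_pow_smul (n + 1) (fun k => e N n j ∘ₗ e N n k)
    (fun k => if j = k then e N n k else 0) (fun M => ?_) k (by omega)
  have := key M j (by omega)
  rw [← sum_pow_smul_e N n M (n + 1) (Nat.lt_succ_self n), linearMap_comp_sum] at this
  simp only [LinearMap.comp_smul] at this
  rw [this]
  simp [smul_ite, Finset.sum_ite_eq, show j < n + 1 by omega]

/-- The case `M = 1`: with one colour there is nothing to shuffle. -/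
theorem sum_e (n : ℕ) : ∑ k ∈ Finset.range (n + 1), e N n k = LinearMap.id := by
  rw [← adams_one, ← sum_pow_smul_e N n 1 (n + 1) (Nat.lt_succ_self n)]
  simp

theorem contractNth_castSucc_apply {M : Type*} (op : M → M → M) {n : ℕ} (j : Fin n)
    (g : Fin (n + 1) → M) (p : Fin n) :
    Fin.contractNth j.castSucc op g p =
      if p = j then op (g j.castSucc) (g j.succ) else g (j.succ.succAbove p) := by
  simp only [Fin.contractNth, Fin.val_castSucc, Fin.succAbove, Fin.lt_def, Fin.val_succ,
    Fin.ext_iff]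
  split_ifs <;> first | rfl | omega | skip
  have : p = j := Fin.ext (by omega)
  rw [this]

theorem face_tprod (n : ℕ) (j : Fin n) (a : Fin (n + 1) → N) :
    face N n j (tprod ℂ a) = tprod ℂ (Fin.contractNth j.castSucc (· * ·) a) :=
  PiTensorProduct.lift.tprod _

theorem d_tprod (n : ℕ) (a : Fin (n + 1) → N) :
    d N n (tprod ℂ a) = ∑ j : Fin n, ((-1 : ℂ) ^ (j : ℕ)) •
      tprod ℂ (Fin.contractNth j.castSucc (· * ·) a) := by
  simp only [d, LinearMap.sum_apply, LinearMap.smul_apply, face_tprod]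

theorem contractNth_swap {n : ℕ} (j : Fin n) (g : Fin (n + 1) → N) :
    Fin.contractNth j.castSucc (· * ·) (g ∘ swap j.castSucc j.succ) =
      Fin.contractNth j.castSucc (· * ·) g := by
  funext p
  rw [contractNth_castSucc_apply, contractNth_castSucc_apply]
  split_ifs with h
  · simp [mul_comm]
  · simp only [Function.comp_apply]
    rw [swap_apply_of_ne_of_ne _ (Fin.succAbove_ne _ _)]
    intro h'
    apply h
    rw [show j.castSucc = j.succ.succAbove j by simp] at h'
    exact Fin.succAbove_right_injective h'

/-- Letters landing in positions `j`, `j + 1` come from neighbours `i`, `i + 1`, so they may be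
multiplied before or after permuting. -/
theorem contractNth_insertPerm {n : ℕ} (i j : Fin n) (s : Perm (Fin n)) (hs : s⁻¹ j = i)
    (a : Fin (n + 1) → N) :
    Fin.contractNth j.castSucc (· * ·) (fun p => a ((insertPerm i.succ j.succ s)⁻¹ p)) =
      fun p => Fin.contractNth i.castSucc (· * ·) a (s⁻¹ p) := by
  funext p
  rw [contractNth_castSucc_apply, contractNth_castSucc_apply, insertPerm_inv_self,
    show j.castSucc = j.succ.succAbove j by simp, insertPerm_inv_succAbove,
    insertPerm_inv_succAbove, hs]
  have : s⁻¹ p = i ↔ p = j := by rw [← hs]; exact (s⁻¹).injective.eq_iff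
  simp only [this, show i.succ.succAbove i = i.castSucc by simp]

/-- By commutativity the face at `j` does not see an exchange of letters `j` and `j + 1`, so by
`sum_sgn_sort_eq` only colourings with equal colours there survive. Those letters were already
neighbours, at `i = (sort c)⁻¹ j`; summing over `i` instead of `j` gives the other side. -/
theorem d_comp_adams (α : Type*) [LinearOrder α] [Fintype α] (n : ℕ) :
    d N n ∘ₗ adams N α (n + 1) = adams N α n ∘ₗ d N n := by
  ext a
  simp only [LinearMap.compMultilinearMap_apply, LinearMap.comp_apply]
  rw [d_tprod, map_sum]
  simp only [map_smul, adams_tprod]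
  rw [map_sum]
  simp only [map_smul, d_tprod, Finset.smul_sum]
  rw [Finset.sum_comm]
  have h : ∀ j : Fin n, ∑ c : Fin (n + 1) → α, sgn (Tuple.sort c) • ((-1 : ℂ) ^ (j : ℕ)) •
      tprod ℂ (Fin.contractNth j.castSucc (· * ·) fun p => a ((Tuple.sort c)⁻¹ p)) =
      ∑ c : Fin n → α, ((-1 : ℂ) ^ (((Tuple.sort c)⁻¹ j : Fin n) : ℕ)) • sgn (Tuple.sort c) •
        tprod ℂ fun p => Fin.contractNth ((Tuple.sort c)⁻¹ j).castSucc (· * ·) a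
          ((Tuple.sort c)⁻¹ p) := by
    intro j
    rw [sum_sgn_sort_eq j fun s => ((-1 : ℂ) ^ (j : ℕ)) •
      tprod ℂ (Fin.contractNth j.castSucc (· * ·) fun p => a (s⁻¹ p))]
    · refine Finset.sum_congr rfl fun c _ => ?_
      rw [contractNth_insertPerm N _ j (Tuple.sort c) rfl, smul_smul, smul_smul]
      congr 1
      rw [pow_add, mul_comm, ← mul_assoc, ← mul_assoc, mul_comm _ ((-1 : ℂ) ^ (j : ℕ)), ← mul_assoc,
        ← pow_add, ← two_mul, pow_mul]
      norm_num
    · intro s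
      have := contractNth_swap N j fun p => a (s⁻¹ p)
      rw [← this]
      congr 2
  rw [Finset.sum_congr rfl fun j _ => h j, Finset.sum_comm]
  refine Eq.trans ?_ Finset.sum_comm
  refine Finset.sum_congr rfl fun c _ => ?_
  exact Equiv.sum_comp (Tuple.sort c)⁻¹ fun i : Fin n => ((-1 : ℂ) ^ (i : ℕ)) • sgn (Tuple.sort c) •
        tprod ℂ fun p => Fin.contractNth i.castSucc (· * ·) a ((Tuple.sort c)⁻¹ p)

theorem d_comp_e (n k : ℕ) : d N n ∘ₗ e N (n + 1) k = e N n k ∘ₗ d N n := by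
  by_cases hk : k < n + 2
  · refine eq_of_sum_pow_smul (n + 2) (fun k => d N n ∘ₗ e N (n + 1) k)
      (fun k => e N n k ∘ₗ d N n) (fun M => ?_) k hk
    have h := d_comp_adams N (Fin M) n
    rw [← sum_pow_smul_e N n M (n + 2) (by omega), ← sum_pow_smul_e N (n + 1) M (n + 2) (by omega),
      linearMap_comp_sum, linearMap_sum_comp] at h
    simpa only [LinearMap.smul_comp, LinearMap.comp_smul] using h
  · rw [e_eq_zero N (by omega : n + 1 < k), e_eq_zero N (by omega : n < k)]
    simp

end Adams

end PlaneCurve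
end

noncomputable section

set_option linter.unusedSectionVars false

namespace PlaneCurve

/-! ### Splitting off the last factor: bar complexes with coefficients -/

section LastFactor

variable {N : Type*} [NonUnitalCommRing N] [Module ℂ N] [IsScalarTower ℂ N N]
  [SMulCommClass ℂ N N]

/-- Splitting off the last factor of a chain. -/
def snocEquiv (n : ℕ) : ((⨂[ℂ]^n N) ⊗[ℂ] N) ≃ₗ[ℂ] (⨂[ℂ]^(n + 1) N) :=
  (TensorProduct.congr (LinearEquiv.refl ℂ _)
    (PiTensorProduct.subsingletonEquiv (R := ℂ) (s := fun _ : Fin 1 => N) 0).symm) ≪≫ₗ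
    TensorPower.mulEquiv

theorem snocEquiv_tmul {n : ℕ} (c : ⨂[ℂ]^n N) (a : N) : snocEquiv n (c ⊗ₜ a) = snoc N c a := by
  simp only [snocEquiv, LinearEquiv.trans_apply, TensorProduct.congr_tmul, LinearEquiv.refl_apply,
    snoc]
  rw [PiTensorProduct.subsingletonEquiv_symm_apply']

@[simp] theorem snocEquiv_symm_snoc {n : ℕ} (c : ⨂[ℂ]^n N) (a : N) :
    (snocEquiv n).symm (snoc N c a) = c ⊗ₜ a := by
  rw [← snocEquiv_tmul, LinearEquiv.symm_apply_apply]

theorem snoc_tprod {n : ℕ} (f : Fin n → N) (a : N) :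
    snoc N (PiTensorProduct.tprod ℂ f) a =
      PiTensorProduct.tprod ℂ (Fin.snoc (α := fun _ => N) f a) := by
  have := TensorPower.tprod_mul_tprod ℂ f (fun _ : Fin 1 => a)
  rw [TensorPower.gMul_def] at this
  rw [snoc, this, Fin.append_right_eq_snoc]

theorem snoc_add {n : ℕ} (c c' : ⨂[ℂ]^n N) (a : N) :
    snoc N (c + c') a = snoc N c a + snoc N c' a := by
  simp only [← snocEquiv_tmul, TensorProduct.add_tmul, map_add]

theorem snoc_smul {n : ℕ} (r : ℂ) (c : ⨂[ℂ]^n N) (a : N) :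
    snoc N (r • c) a = r • snoc N c a := by
  simp only [← snocEquiv_tmul, ← TensorProduct.smul_tmul', map_smul]

theorem snoc_sum {n : ℕ} {ι : Type*} (s : Finset ι) (c : ι → ⨂[ℂ]^n N) (a : N) :
    snoc N (∑ i ∈ s, c i) a = ∑ i ∈ s, snoc N (c i) a := by
  simp only [← snocEquiv_tmul, TensorProduct.sum_tmul, map_sum]

theorem snoc_add_right {n : ℕ} (c : ⨂[ℂ]^n N) (a b : N) :
    snoc N c (a + b) = snoc N c a + snoc N c b := by
  simp only [← snocEquiv_tmul, TensorProduct.tmul_add, map_add]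

theorem snoc_sum_right {n : ℕ} {ι : Type*} (s : Finset ι) (c : ⨂[ℂ]^n N) (a : ι → N) :
    snoc N c (∑ i ∈ s, a i) = ∑ i ∈ s, snoc N c (a i) := by
  simp only [← snocEquiv_tmul, TensorProduct.tmul_sum, map_sum]

theorem snoc_smul_right {n : ℕ} (r : ℂ) (c : ⨂[ℂ]^n N) (a : N) :
    snoc N c (r • a) = r • snoc N c a := by
  simp only [← snocEquiv_tmul, TensorProduct.tmul_smul, map_smul]

theorem snoc_zero_right {n : ℕ} (c : ⨂[ℂ]^n N) : snoc N c 0 = 0 := by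
  simp only [← snocEquiv_tmul, TensorProduct.tmul_zero, map_zero]

theorem snoc_zero {n : ℕ} (a : N) : snoc N (0 : ⨂[ℂ]^n N) a = 0 := by
  simp only [← snocEquiv_tmul, TensorProduct.zero_tmul, map_zero]

theorem snoc_neg_right {n : ℕ} (c : ⨂[ℂ]^n N) (a : N) : snoc N c (-a) = -snoc N c a := by
  simp only [← snocEquiv_tmul, TensorProduct.tmul_neg, map_neg]

variable {V : Type*} [AddCommGroup V] [Module ℂ V]

theorem ext_snoc {n : ℕ} {f g : (⨂[ℂ]^(n + 1) N) →ₗ[ℂ] V}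
    (h : ∀ c a, f (snoc N c a) = g (snoc N c a)) : f = g := by
  have : f ∘ₗ (snocEquiv n).toLinearMap = g ∘ₗ (snocEquiv n).toLinearMap := by
    refine TensorProduct.ext' fun c a => ?_
    simpa [snocEquiv_tmul] using h c a
  ext1
  refine MultilinearMap.ext fun a => ?_
  simpa using LinearMap.congr_fun this ((snocEquiv n).symm (PiTensorProduct.tprod ℂ a))

theorem contractNth_castSucc_snoc {n : ℕ} (j : Fin n) (f : Fin (n + 1) → N) (a : N) :
    Fin.contractNth j.castSucc.castSucc (· * ·) (Fin.snoc (α := fun _ => N) f a) =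
      Fin.snoc (α := fun _ => N) (Fin.contractNth j.castSucc (· * ·) f) a := by
  funext p
  rw [contractNth_castSucc_apply]
  induction p using Fin.lastCases with
  | last =>
    rw [if_neg (Fin.castSucc_lt_last j).ne', Fin.snoc_last,
      Fin.succAbove_of_le_castSucc _ _ (by simp [Fin.le_def]), Fin.succ_last, Fin.snoc_last]
  | cast p =>
    rw [Fin.snoc_castSucc, Fin.snoc_castSucc, contractNth_castSucc_apply, Fin.succ_castSucc,
      Fin.snoc_castSucc, Fin.castSucc_succAbove_castSucc, Fin.snoc_castSucc]
    simp

theorem contractNth_last_snoc_snoc {n : ℕ} (f : Fin n → N) (b a : N) :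
    Fin.contractNth (Fin.last n).castSucc (· * ·)
      (Fin.snoc (α := fun _ => N) (Fin.snoc (α := fun _ => N) f b) a) =
      Fin.snoc (α := fun _ => N) f (b * a) := by
  funext p
  rw [contractNth_castSucc_apply]
  induction p using Fin.lastCases with
  | last => simp
  | cast p =>
    rw [if_neg (Fin.castSucc_lt_last p).ne, Fin.snoc_castSucc,
      Fin.succAbove_of_castSucc_lt _ _ (by simp [Fin.lt_def]), Fin.snoc_castSucc,
      Fin.snoc_castSucc]

theorem face_castSucc_snoc {n : ℕ} (j : Fin n) (c : ⨂[ℂ]^(n + 1) N) (a : N) :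
    face N (n + 1) j.castSucc (snoc N c a) = snoc N (face N n j c) a := by
  have : face N (n + 1) j.castSucc ∘ₗ (snocEquiv (n + 1)).toLinearMap =
      (snocEquiv n).toLinearMap ∘ₗ LinearMap.rTensor N (face N n j) := by
    ext f b
    simp only [LinearMap.compMultilinearMap_apply, TensorProduct.AlgebraTensorModule.curry_apply,
      LinearMap.restrictScalars_self, TensorProduct.curry_apply, LinearMap.comp_apply,
      LinearEquiv.coe_coe, LinearMap.rTensor_tmul, snocEquiv_tmul, snoc_tprod, face_tprod,
      contractNth_castSucc_snoc]
  simpa [snocEquiv_tmul] using LinearMap.congr_fun this (c ⊗ₜ a)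

theorem face_last_snoc_snoc {n : ℕ} (u : ⨂[ℂ]^n N) (b a : N) :
    face N (n + 1) (Fin.last n) (snoc N (snoc N u b) a) = snoc N u (b * a) := by
  induction u using PiTensorProduct.induction_on with
  | smul_tprod r f =>
    simp only [snoc_smul, map_smul, snoc_tprod, face_tprod, contractNth_last_snoc_snoc]
  | add x y hx hy => simp only [snoc_add, map_add, hx, hy]

theorem d_zero : d N 0 = 0 := by simp [d]

/-- Only the last face involves the final factor; this recursion drives all later computations with
`d`. -/
theorem d_snoc_snoc {n : ℕ} (u : ⨂[ℂ]^n N) (b a : N) :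
    d N (n + 1) (snoc N (snoc N u b) a) =
      snoc N (d N n (snoc N u b)) a + (-1 : ℂ) ^ n • snoc N u (b * a) := by
  simp only [d, Fin.sum_univ_castSucc, LinearMap.add_apply, LinearMap.sum_apply,
    LinearMap.smul_apply, face_castSucc_snoc, face_last_snoc_snoc, Fin.val_castSucc, Fin.val_last,
    snoc_sum, snoc_smul]

variable {X Y : Type*} [AddCommGroup X] [Module ℂ X] [AddCommGroup Y] [Module ℂ Y]

/-- `u ⊗ b ⊗ x ↦ u ⊗ f(b, x)`. -/
def mergeWith (f : N →ₗ[ℂ] X →ₗ[ℂ] Y) (n : ℕ) :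
    (⨂[ℂ]^(n + 1) N) ⊗[ℂ] X →ₗ[ℂ] (⨂[ℂ]^n N) ⊗[ℂ] Y :=
  LinearMap.lTensor _ (TensorProduct.lift f) ∘ₗ (TensorProduct.assoc ℂ _ _ _).toLinearMap ∘ₗ
    LinearMap.rTensor X (snocEquiv n).symm.toLinearMap

@[simp] theorem mergeWith_tmul (f : N →ₗ[ℂ] X →ₗ[ℂ] Y) {n : ℕ} (u : ⨂[ℂ]^n N) (b : N) (x : X) :
    mergeWith f n (snoc N u b ⊗ₜ x) = u ⊗ₜ f b x := by
  simp [mergeWith]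

/-- The differential of the bar complex with coefficients in a module `X`. -/
def bdry (act : N →ₗ[ℂ] X →ₗ[ℂ] X) (n : ℕ) :
    (⨂[ℂ]^(n + 1) N) ⊗[ℂ] X →ₗ[ℂ] (⨂[ℂ]^n N) ⊗[ℂ] X :=
  LinearMap.rTensor X (d N n) + (-1 : ℂ) ^ n • mergeWith act n

theorem bdry_tmul (act : N →ₗ[ℂ] X →ₗ[ℂ] X) {n : ℕ} (u : ⨂[ℂ]^n N) (b : N) (x : X) :
    bdry act n (snoc N u b ⊗ₜ x) = d N n (snoc N u b) ⊗ₜ x + (-1 : ℂ) ^ n • (u ⊗ₜ act b x) := by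
  simp [bdry]

theorem ext_snoc_tmul {n : ℕ} {f g : (⨂[ℂ]^(n + 1) N) ⊗[ℂ] X →ₗ[ℂ] V}
    (h : ∀ c a x, f (snoc N c a ⊗ₜ x) = g (snoc N c a ⊗ₜ x)) : f = g := by
  apply TensorProduct.ext
  refine ext_snoc fun c a => ?_
  ext x
  exact h c a x

/-- The last factor plays the role of a module, so it can be replaced by a free resolution. -/
theorem d_comp_snocEquiv (n : ℕ) :
    d N (n + 1) ∘ₗ (snocEquiv (n + 1)).toLinearMap =
      (snocEquiv n).toLinearMap ∘ₗ bdry (LinearMap.mul ℂ N) n := by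
  refine ext_snoc_tmul fun u b a => ?_
  simp only [LinearMap.comp_apply, LinearEquiv.coe_coe, snocEquiv_tmul, bdry_tmul, map_add,
    map_smul, d_snoc_snoc, LinearMap.mul_apply']

/-- Assuming `d ∘ d = 0` in just one degree allows `d_comp_d` to be proved by induction, taking `X =
N`. -/
theorem bdry_comp_bdry_of (act : N →ₗ[ℂ] X →ₗ[ℂ] X)
    (hact : ∀ a b x, act (a * b) x = act a (act b x)) (n : ℕ)
    (hd : d N n ∘ₗ d N (n + 1) = 0) : bdry act n ∘ₗ bdry act (n + 1) = 0 := by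
  refine ext_snoc_tmul fun v b x => ?_
  have h : ((bdry act n ∘ₗ bdry act (n + 1) ∘ₗ (TensorProduct.mk ℂ _ X).flip x) ∘ₗ
      (snocEquiv (n + 1)).toLinearMap ∘ₗ (TensorProduct.mk ℂ _ N).flip b) = 0 := by
    refine ext_snoc fun w c => ?_
    have hd' := LinearMap.congr_fun hd (snoc N (snoc N w c) b)
    simp only [LinearMap.comp_apply, LinearMap.zero_apply, LinearEquiv.coe_coe,
      LinearMap.flip_apply, TensorProduct.mk_apply, snocEquiv_tmul] at hd' ⊢
    rw [bdry_tmul, map_add, map_smul, bdry_tmul, bdry, LinearMap.add_apply,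
      LinearMap.rTensor_tmul, hd', TensorProduct.zero_tmul, zero_add, LinearMap.smul_apply,
      d_snoc_snoc, TensorProduct.add_tmul, ← TensorProduct.smul_tmul', map_add, map_smul,
      mergeWith_tmul, mergeWith_tmul, hact, smul_add, smul_add, pow_succ]
    have h1 : ((-1 : ℂ) ^ n) * (-1) ^ n = 1 := by rw [← mul_pow]; simp
    simp only [smul_smul, mul_neg, mul_one, neg_mul, h1]
    module
  simpa [snocEquiv_tmul] using LinearMap.congr_fun h v

theorem d_comp_d (n : ℕ) : d N n ∘ₗ d N (n + 1) = 0 := by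
  induction n with
  | zero => rw [d_zero, LinearMap.zero_comp]
  | succ n ih =>
    have h : (d N (n + 1) ∘ₗ d N (n + 2)) ∘ₗ (snocEquiv (n + 2)).toLinearMap = 0 := by
      rw [LinearMap.comp_assoc, d_comp_snocEquiv, ← LinearMap.comp_assoc, d_comp_snocEquiv,
        LinearMap.comp_assoc, bdry_comp_bdry_of _ (fun a b x => by simp [mul_assoc]) n ih,
        LinearMap.comp_zero]
    refine LinearMap.ext fun z => ?_
    simpa using LinearMap.congr_fun h ((snocEquiv (n + 2)).symm z)

theorem bdry_comp_bdry (act : N →ₗ[ℂ] X →ₗ[ℂ] X)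
    (hact : ∀ a b x, act (a * b) x = act a (act b x)) (n : ℕ) :
    bdry act n ∘ₗ bdry act (n + 1) = 0 :=
  bdry_comp_bdry_of act hact n (d_comp_d n)

theorem bdry_comp_lTensor (act : N →ₗ[ℂ] X →ₗ[ℂ] X) (act' : N →ₗ[ℂ] Y →ₗ[ℂ] Y) (f : X →ₗ[ℂ] Y)
    (hf : ∀ a x, f (act a x) = act' a (f x)) (n : ℕ) :
    bdry act' n ∘ₗ LinearMap.lTensor _ f = LinearMap.lTensor _ f ∘ₗ bdry act n := by
  refine ext_snoc_tmul fun u b x => ?_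
  simp only [LinearMap.comp_apply, LinearMap.lTensor_tmul, bdry_tmul, map_add, map_smul, hf]

end LastFactor

end PlaneCurve
end

noncomputable section

set_option linter.unusedSectionVars false

namespace PlaneCurve

/-! ### Upper bound for the homology from a minimal free resolution -/

section Resolution

variable {N : Type*} [NonUnitalCommRing N] [Module ℂ N] [IsScalarTower ℂ N N]
  [SMulCommClass ℂ N N] {A : Type*} [CommRing A] [Algebra ℂ A]

variable (N A) in
/-- A commutative algebra `A` with augmentation `aug` and augmentation ideal `N`. -/
structure Augmentation where
  incl : N →ₗ[ℂ] A
  proj : A →ₗ[ℂ] N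
  aug : A →ₗ[ℂ] ℂ
  incl_mul : ∀ a b, incl (a * b) = incl a * incl b
  proj_mul : ∀ b a, proj (incl b * a) = b * proj a + aug a • b
  incl_proj : ∀ a, aug a • 1 + incl (proj a) = a

namespace Augmentation

variable (α : Augmentation N A)

/-- The action of `N` on pairs of elements of `A`. -/
def act : N →ₗ[ℂ] (Fin 2 → A) →ₗ[ℂ] (Fin 2 → A) :=
  LinearMap.mk₂ ℂ (fun b x i => α.incl b * x i)
    (fun b b' x => by funext i; simp [add_mul]) (fun r b x => by funext i; simp)
    (fun b x x' => by funext i; simp [mul_add]) (fun r b x => by funext i; simp)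

theorem act_apply (b : N) (x : Fin 2 → A) : α.act b x = fun i => α.incl b * x i := rfl

theorem act_mul (a b : N) (x : Fin 2 → A) : α.act (a * b) x = α.act a (α.act b x) := by
  funext i
  simp [act_apply, α.incl_mul, mul_assoc]

/-- The contracting homotopy `w ⊗ x ↦ ∑ᵢ w ⊗ (xᵢ - aug xᵢ) ⊗ eᵢ`. -/
def homotopy (n : ℕ) : (⨂[ℂ]^n N) ⊗[ℂ] (Fin 2 → A) →ₗ[ℂ] (⨂[ℂ]^(n + 1) N) ⊗[ℂ] (Fin 2 → A) :=
  ∑ i : Fin 2, (TensorProduct.mk ℂ _ _).flip (Pi.single i 1) ∘ₗ (snocEquiv n).toLinearMap ∘ₗ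
    LinearMap.lTensor _ (α.proj ∘ₗ LinearMap.proj i)

theorem homotopy_tmul {n : ℕ} (w : ⨂[ℂ]^n N) (x : Fin 2 → A) :
    α.homotopy n (w ⊗ₜ x) = ∑ i : Fin 2, snoc N w (α.proj (x i)) ⊗ₜ[ℂ] Pi.single i (1 : A) := by
  simp [homotopy, snocEquiv_tmul]

/-- The constant part of a pair. -/
def const (x : Fin 2 → A) : Fin 2 → A := fun i => α.aug (x i) • 1

theorem sum_single (x : Fin 2 → A) :
    x = α.const x + ∑ i : Fin 2, α.act (α.proj (x i)) (Pi.single i 1) := by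
  funext i
  have := α.incl_proj (x i)
  fin_cases i <;> simpa [const, act_apply] using this.symm

theorem const_eq_sum (x : Fin 2 → A) :
    α.const x = ∑ i : Fin 2, α.aug (x i) • (Pi.single i (1 : A) : Fin 2 → A) := by
  funext i
  fin_cases i <;> simp [const]

/-- The homotopy moves the augmentation-ideal part of each coefficient into a new bar factor. The
new last face restores that part, and `proj_mul` supplies the constant part. -/
theorem bdry_homotopy (n : ℕ) (z : (⨂[ℂ]^(n + 1) N) ⊗[ℂ] (Fin 2 → A)) :
    bdry α.act (n + 1) (α.homotopy (n + 1) z) - α.homotopy n (bdry α.act n z) =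
      (-1 : ℂ) ^ (n + 1) • z := by
  have : bdry α.act (n + 1) ∘ₗ α.homotopy (n + 1) - α.homotopy n ∘ₗ bdry α.act n =
      (-1 : ℂ) ^ (n + 1) • LinearMap.id := by
    refine ext_snoc_tmul fun w b x => ?_
    simp only [LinearMap.sub_apply, LinearMap.comp_apply, LinearMap.smul_apply,
      LinearMap.id_apply, homotopy_tmul, map_sum, bdry_tmul, map_add, map_smul, d_snoc_snoc,
      act_apply, α.proj_mul]
    conv_rhs => rw [α.sum_single x, α.const_eq_sum x, ← Finset.sum_add_distrib,
      TensorProduct.tmul_sum, Finset.smul_sum]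
    rw [Finset.smul_sum, ← Finset.sum_add_distrib, ← Finset.sum_sub_distrib]
    refine Finset.sum_congr rfl fun i _ => ?_
    simp only [snoc_add_right, snoc_smul_right, TensorProduct.add_tmul, TensorProduct.tmul_add,
      ← TensorProduct.smul_tmul', TensorProduct.tmul_smul, act_apply, pow_succ]
    module
  simpa using LinearMap.congr_fun this z

theorem exists_of_bdry_eq_zero (n : ℕ) (z : (⨂[ℂ]^(n + 1) N) ⊗[ℂ] (Fin 2 → A))
    (hz : bdry α.act n z = 0) :
    bdry α.act (n + 1) ((-1 : ℂ) ^ (n + 1) • α.homotopy (n + 1) z) = z := by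
  have := α.bdry_homotopy n z
  rw [hz, map_zero, sub_zero] at this
  rw [map_smul, this, smul_smul, ← mul_pow]
  simp

/-- Constant pairs. -/
def ofConst : (Fin 2 → ℂ) →ₗ[ℂ] (Fin 2 → A) :=
  LinearMap.pi fun i => (Algebra.linearMap ℂ A) ∘ₗ LinearMap.proj i

/-- The class of the empty word. -/
abbrev emptyWord : ⨂[ℂ]^0 N := PiTensorProduct.tprod ℂ Fin.elim0

theorem eq_smul_emptyWord (w : ⨂[ℂ]^0 N) : ∃ r : ℂ, w = r • emptyWord := by
  induction w using PiTensorProduct.induction_on with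
  | smul_tprod r f => exact ⟨r, by rw [show f = Fin.elim0 from Subsingleton.elim _ _]⟩
  | add x y hx hy =>
    obtain ⟨r, rfl⟩ := hx
    obtain ⟨s, rfl⟩ := hy
    exact ⟨r + s, by rw [add_smul]⟩

/-- On the empty word there is no preceding bar factor, so the constants survive; they are the only
homology. -/
theorem bdry_homotopy_zero (r : ⨂[ℂ]^0 N) (x : Fin 2 → A) :
    bdry α.act 0 (α.homotopy 0 (r ⊗ₜ x)) = r ⊗ₜ x - r ⊗ₜ α.const x := by
  conv_rhs => rw [α.sum_single x, TensorProduct.tmul_add, ← α.sum_single x, add_sub_cancel_left]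
  rw [homotopy_tmul, map_sum, TensorProduct.tmul_sum]
  exact Finset.sum_congr rfl fun i _ => by
    rw [bdry_tmul, d_zero, LinearMap.zero_apply, TensorProduct.zero_tmul, zero_add, pow_zero,
      one_smul]

theorem exists_zero (z : (⨂[ℂ]^0 N) ⊗[ℂ] (Fin 2 → A)) :
    ∃ (l : Fin 2 → ℂ) (y : (⨂[ℂ]^1 N) ⊗[ℂ] (Fin 2 → A)),
      z = emptyWord ⊗ₜ ofConst l + bdry α.act 0 y := by
  induction z using TensorProduct.induction_on with
  | zero => exact ⟨0, 0, by simp⟩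
  | tmul w x =>
    obtain ⟨r, rfl⟩ := eq_smul_emptyWord w
    refine ⟨fun i => r * α.aug (x i), α.homotopy 0 ((r • emptyWord) ⊗ₜ x), ?_⟩
    rw [bdry_homotopy_zero]
    have : (ofConst fun i => r * α.aug (x i) : Fin 2 → A) = r • α.const x := by
      funext i
      simp [ofConst, const, Algebra.algebraMap_eq_smul_one, mul_smul]
    rw [this, TensorProduct.tmul_smul, TensorProduct.smul_tmul']
    abel
  | add z z' h h' =>
    obtain ⟨l, y, rfl⟩ := h
    obtain ⟨l', y', rfl⟩ := h'
    refine ⟨l + l', y + y', ?_⟩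
    rw [map_add, map_add, TensorProduct.tmul_add]
    abel

end Augmentation

/-- A minimal resolution of `N` by free modules of rank two. -/
structure RankTwoResolution (α : Augmentation N A) where
  map : ℕ → (Fin 2 → A) →ₗ[ℂ] (Fin 2 → A)
  cover : (Fin 2 → A) →ₗ[ℂ] N
  map_act : ∀ s a x, map s (α.act a x) = α.act a (map s x)
  cover_act : ∀ a x, cover (α.act a x) = a * cover x
  exact_map : ∀ s, Function.Exact (map (s + 1)) (map s)
  exact_cover : Function.Exact (map 0) cover
  cover_surjective : Function.Surjective cover
  minimal : ∀ s l i, α.aug (map s (Augmentation.ofConst l) i) = 0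

namespace RankTwoResolution

variable {α : Augmentation N A} (F : RankTwoResolution α)

/-- The generators of the homology, up to boundaries. -/
def gen : (m s : ℕ) → (Fin 2 → ℂ) →ₗ[ℂ] (⨂[ℂ]^m N) ⊗[ℂ] (Fin 2 → A)
  | 0, _ => TensorProduct.mk ℂ _ _ Augmentation.emptyWord ∘ₗ Augmentation.ofConst
  | m + 1, s => (-1 : ℂ) ^ m • (α.homotopy m ∘ₗ LinearMap.lTensor _ (F.map s) ∘ₗ gen m (s + 1))

theorem bdry_lTensor_map (m s : ℕ) (z : (⨂[ℂ]^(m + 1) N) ⊗[ℂ] (Fin 2 → A)) :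
    bdry α.act m (LinearMap.lTensor _ (F.map s) z) =
      LinearMap.lTensor _ (F.map s) (bdry α.act m z) :=
  LinearMap.congr_fun (bdry_comp_lTensor α.act α.act (F.map s) (F.map_act s) m) z

theorem bdry_lTensor_cover (m : ℕ) (z : (⨂[ℂ]^(m + 1) N) ⊗[ℂ] (Fin 2 → A)) :
    bdry (LinearMap.mul ℂ N) m (LinearMap.lTensor _ F.cover z) =
      LinearMap.lTensor _ F.cover (bdry α.act m z) :=
  LinearMap.congr_fun (bdry_comp_lTensor α.act (LinearMap.mul ℂ N) F.cover F.cover_act m) z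

theorem lTensor_map_map (m s : ℕ) (z : (⨂[ℂ]^m N) ⊗[ℂ] (Fin 2 → A)) :
    LinearMap.lTensor _ (F.map s) (LinearMap.lTensor _ (F.map (s + 1)) z) = 0 :=
  (Module.Flat.lTensor_exact (⨂[ℂ]^m N) (F.exact_map s)).apply_apply_eq_zero z

theorem lTensor_cover_map (m : ℕ) (z : (⨂[ℂ]^m N) ⊗[ℂ] (Fin 2 → A)) :
    LinearMap.lTensor _ F.cover (LinearMap.lTensor _ (F.map 0) z) = 0 :=
  (Module.Flat.lTensor_exact (⨂[ℂ]^m N) F.exact_cover).apply_apply_eq_zero z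

/-- Each generator is a homotopy preimage of the image of the previous one. At `m = 0` the
obstruction is a constant part, which vanishes by minimality. -/
theorem bdry_gen (m : ℕ) : ∀ (s : ℕ) (l : Fin 2 → ℂ), bdry α.act m (F.gen (m + 1) s l) =
    LinearMap.lTensor _ (F.map s) (F.gen m (s + 1) l) := by
  induction m with
  | zero =>
    intro s l
    have h : α.const (F.map s (Augmentation.ofConst l)) = 0 := by
      funext i
      simp [Augmentation.const, F.minimal]
    simp [gen, α.bdry_homotopy_zero, h]
  | succ m ih =>
    intro s l
    rw [gen, LinearMap.smul_apply, LinearMap.comp_apply, LinearMap.comp_apply]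
    refine α.exists_of_bdry_eq_zero m _ ?_
    rw [bdry_lTensor_map, ih, lTensor_map_map]

/-- A staircase chase: exactness of the resolution (tensoring over a field is flat) passes from `(m,
s)` to `(m - 1, s + 1)` until the empty word is reached. On the way back, the corrected element is
closed, hence exact by the homotopy. -/
theorem exists_decomposition (m : ℕ) : ∀ (s : ℕ) (u : (⨂[ℂ]^(m + 1) N) ⊗[ℂ] (Fin 2 → A))
    (u' : (⨂[ℂ]^m N) ⊗[ℂ] (Fin 2 → A)),
    bdry α.act m u = LinearMap.lTensor _ (F.map s) u' →
    ∃ l y y', u = F.gen (m + 1) s l + LinearMap.lTensor _ (F.map s) y + bdry α.act (m + 1) y' := by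
  induction m with
  | zero =>
    intro s u u' h
    obtain ⟨l, y, rfl⟩ := α.exists_zero u'
    refine ⟨l, y, (-1 : ℂ) ^ 1 • α.homotopy 1 (u - F.gen 1 s l - LinearMap.lTensor _ (F.map s) y),
      ?_⟩
    rw [α.exists_of_bdry_eq_zero]
    · abel
    · rw [map_sub, map_sub, h, bdry_gen, bdry_lTensor_map, map_add]
      simp [gen]
  | succ m ih =>
    intro s u u' h
    have h1 : LinearMap.lTensor _ (F.map s) (bdry α.act m u') = 0 := by
      rw [← bdry_lTensor_map, ← h]
      exact LinearMap.congr_fun (bdry_comp_bdry α.act α.act_mul m) u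
    obtain ⟨u'', hu''⟩ := (Module.Flat.lTensor_exact (⨂[ℂ]^m N) (F.exact_map s) _).1 h1
    obtain ⟨l, y, y', rfl⟩ := ih (s + 1) u' u'' hu''.symm
    refine ⟨l, y', (-1 : ℂ) ^ (m + 2) • α.homotopy (m + 2)
      (u - F.gen (m + 2) s l - LinearMap.lTensor _ (F.map s) y'), ?_⟩
    rw [α.exists_of_bdry_eq_zero]
    · abel
    · rw [map_sub, map_sub, h, bdry_gen, bdry_lTensor_map, map_add, map_add, lTensor_map_map]
      abel

/-- The cycles spanning the homology. -/
def genCycle (m : ℕ) : (Fin 2 → ℂ) →ₗ[ℂ] (⨂[ℂ]^(m + 1) N) :=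
  (snocEquiv m).toLinearMap ∘ₗ LinearMap.lTensor _ F.cover ∘ₗ F.gen m 0

theorem d_snocEquiv (m : ℕ) (z : (⨂[ℂ]^(m + 1) N) ⊗[ℂ] N) :
    d N (m + 1) (snocEquiv (m + 1) z) = snocEquiv m (bdry (LinearMap.mul ℂ N) m z) :=
  LinearMap.congr_fun (d_comp_snocEquiv m) z

theorem genCycle_mem (m : ℕ) (l : Fin 2 → ℂ) : F.genCycle m l ∈ cycles N (m + 1) := by
  cases m with
  | zero => simp [cycles, d_zero]
  | succ m =>
    change d N (m + 1) _ = 0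
    rw [genCycle, LinearMap.comp_apply, LinearMap.comp_apply, LinearEquiv.coe_coe, d_snocEquiv,
      bdry_lTensor_cover, bdry_gen, lTensor_cover_map, map_zero]

/-- Lift `z` through the cover: the boundary of the lift comes from the first syzygies, so
`exists_decomposition` applies, and the cover kills its middle term. -/
theorem exists_sub_mem_boundaries (m : ℕ) (z : ⨂[ℂ]^(m + 1) N) (hz : z ∈ cycles N (m + 1)) :
    ∃ l, z - F.genCycle m l ∈ boundaries N (m + 1) := by
  obtain ⟨v, rfl⟩ := (snocEquiv m).surjective z
  obtain ⟨u, rfl⟩ := LinearMap.lTensor_surjective (⨂[ℂ]^m N) F.cover_surjective v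
  have key : ∀ (l : Fin 2 → ℂ) y, LinearMap.lTensor _ F.cover u =
      LinearMap.lTensor _ F.cover (F.gen m 0 l + bdry α.act m y) →
      snocEquiv m (LinearMap.lTensor _ F.cover u) - F.genCycle m l ∈ boundaries N (m + 1) := by
    intro l y h
    refine ⟨snocEquiv (m + 1) (LinearMap.lTensor _ F.cover y), ?_⟩
    rw [d_snocEquiv, bdry_lTensor_cover, h, genCycle, LinearMap.comp_apply, LinearMap.comp_apply,
      LinearEquiv.coe_coe, ← map_sub, map_add, add_sub_cancel_left]
  cases m with
  | zero =>
    obtain ⟨l, y, rfl⟩ := α.exists_zero u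
    exact ⟨l, key l y rfl⟩
  | succ m =>
    have hz' : d N (m + 1) _ = 0 := hz
    rw [d_snocEquiv, bdry_lTensor_cover, LinearEquiv.map_eq_zero_iff] at hz'
    obtain ⟨u', hu'⟩ := (Module.Flat.lTensor_exact (⨂[ℂ]^m N) F.exact_cover _).1 hz'
    obtain ⟨l, y, y', rfl⟩ := F.exists_decomposition m 0 u u' hu'.symm
    refine ⟨l, key l y' ?_⟩
    rw [map_add, map_add, lTensor_cover_map, map_add, add_zero]

theorem finite_hoch_and_finrank_le (F : RankTwoResolution α) (m : ℕ) :
    Module.Finite ℂ (Hoch N (m + 1)) ∧ Module.finrank ℂ (Hoch N (m + 1)) ≤ 2 := by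
  let f : (Fin 2 → ℂ) →ₗ[ℂ] Hoch N (m + 1) :=
    Submodule.mkQ _ ∘ₗ LinearMap.codRestrict (cycles N (m + 1)) (F.genCycle m) (F.genCycle_mem m)
  have hf : Function.Surjective f := by
    intro q
    obtain ⟨⟨z, hz⟩, rfl⟩ := Submodule.Quotient.mk_surjective _ q
    obtain ⟨l, hl⟩ := F.exists_sub_mem_boundaries m z hz
    refine ⟨l, Eq.symm ?_⟩
    exact (Submodule.Quotient.eq _).2 hl
  refine ⟨Module.Finite.of_surjective f hf, ?_⟩
  have := LinearMap.finrank_range_le f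
  rwa [LinearMap.range_eq_top.2 hf, finrank_top, Module.finrank_fin_fun] at this

end RankTwoResolution

end Resolution

end PlaneCurve
end

noncomputable section

set_option linter.unusedSectionVars false
set_option linter.unusedSimpArgs false

namespace PlaneCurve

/-! ### Contraction of adjacent factors with a bilinear form -/

section Contraction

variable {N : Type*} [NonUnitalCommRing N] [Module ℂ N] [IsScalarTower ℂ N N]
  [SMulCommClass ℂ N N]

open Equiv

/-- `u ⊗ a ↦ δ(a) u`. -/
def evalLast (δ : N →ₗ[ℂ] ℂ) (n : ℕ) : (⨂[ℂ]^(n + 1) N) →ₗ[ℂ] (⨂[ℂ]^n N) :=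
  (TensorProduct.rid ℂ _).toLinearMap ∘ₗ LinearMap.lTensor _ δ ∘ₗ (snocEquiv n).symm.toLinearMap

@[simp] theorem evalLast_snoc (δ : N →ₗ[ℂ] ℂ) {n : ℕ} (u : ⨂[ℂ]^n N) (a : N) :
    evalLast δ n (snoc N u a) = δ a • u := by
  simp [evalLast]

/-- `u ⊗ a ⊗ b ↦ β(a, b) u`. -/
def contractLast (β : N →ₗ[ℂ] N →ₗ[ℂ] ℂ) (n : ℕ) : (⨂[ℂ]^(n + 2) N) →ₗ[ℂ] (⨂[ℂ]^n N) :=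
  (TensorProduct.rid ℂ _).toLinearMap ∘ₗ mergeWith β n ∘ₗ (snocEquiv (n + 1)).symm.toLinearMap

@[simp] theorem contractLast_snoc_snoc (β : N →ₗ[ℂ] N →ₗ[ℂ] ℂ) {n : ℕ} (u : ⨂[ℂ]^n N) (a b : N) :
    contractLast β n (snoc N (snoc N u a) b) = β a b • u := by
  simp [contractLast]

/-- Contraction of the factors in positions `i` and `i + 1`. -/
def contract (β : N →ₗ[ℂ] N →ₗ[ℂ] ℂ) : (n : ℕ) → Fin (n + 1) →
    (⨂[ℂ]^(n + 2) N) →ₗ[ℂ] (⨂[ℂ]^n N)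
  | 0, _ => contractLast β 0
  | n + 1, i => Fin.lastCases (contractLast β (n + 1)) (fun i => (snocEquiv n).toLinearMap ∘ₗ
      LinearMap.rTensor N (contract β n i) ∘ₗ (snocEquiv (n + 2)).symm.toLinearMap) i

theorem contract_last (β : N →ₗ[ℂ] N →ₗ[ℂ] ℂ) (n : ℕ) :
    contract β n (Fin.last n) = contractLast β n := by
  cases n with
  | zero => rfl
  | succ n => rw [contract, Fin.lastCases_last]

theorem contract_castSucc_snoc (β : N →ₗ[ℂ] N →ₗ[ℂ] ℂ) (n : ℕ) (i : Fin (n + 1))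
    (c : ⨂[ℂ]^(n + 2) N) (a : N) :
    contract β (n + 1) i.castSucc (snoc N c a) = snoc N (contract β n i c) a := by
  rw [contract, Fin.lastCases_castSucc]
  simp [snocEquiv_tmul]

theorem contractLast_tprod (β : N →ₗ[ℂ] N →ₗ[ℂ] ℂ) (n : ℕ) (f : Fin (n + 2) → N) :
    contractLast β n (PiTensorProduct.tprod ℂ f) =
      β (f (Fin.last n).castSucc) (f (Fin.last (n + 1))) •
        PiTensorProduct.tprod ℂ fun p : Fin n => f p.castSucc.castSucc := by
  have h : f = Fin.snoc (α := fun _ => N) (Fin.snoc (α := fun _ => N)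
      (fun p : Fin n => f p.castSucc.castSucc) (f (Fin.last n).castSucc)) (f (Fin.last (n + 1))) := by
    funext p
    induction p using Fin.lastCases with
    | last => simp
    | cast p => induction p using Fin.lastCases <;> simp
  conv_lhs => rw [h, ← snoc_tprod, ← snoc_tprod, contractLast_snoc_snoc]

theorem contract_tprod (β : N →ₗ[ℂ] N →ₗ[ℂ] ℂ) (n : ℕ) (i : Fin (n + 1)) (f : Fin (n + 2) → N) :
    contract β n i (PiTensorProduct.tprod ℂ f) = β (f i.castSucc) (f i.succ) •
      PiTensorProduct.tprod ℂ fun p : Fin n => f (i.succ.succAbove (i.succAbove p)) := by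
  have hlast : ∀ n (f : Fin (n + 2) → N), contract β n (Fin.last n) (PiTensorProduct.tprod ℂ f) =
      β (f (Fin.last n).castSucc) (f (Fin.last n).succ) •
      PiTensorProduct.tprod ℂ fun p : Fin n =>
        f ((Fin.last n).succ.succAbove ((Fin.last n).succAbove p)) := by
    intro n f
    rw [contract_last, contractLast_tprod]
    simp
  induction n with
  | zero =>
    rw [show i = Fin.last 0 from Fin.ext (by omega)]
    exact hlast 0 f
  | succ n ih =>
    induction i using Fin.lastCases with
    | last => exact hlast _ f
    | cast i =>
      have h : f = Fin.snoc (α := fun _ => N) (fun p : Fin (n + 2) => f p.castSucc)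
          (f (Fin.last (n + 2))) := by
        funext p
        induction p using Fin.lastCases <;> simp
      conv_lhs => rw [h, ← snoc_tprod, contract_castSucc_snoc, ih, snoc_smul, snoc_tprod]
      rw [Fin.succ_castSucc]
      congr 2
      funext p
      induction p using Fin.lastCases with
      | last =>
        rw [Fin.snoc_last, Fin.succAbove_of_le_castSucc i.castSucc _ (by simp [Fin.le_def]; omega),
          Fin.succ_last, Fin.succAbove_of_le_castSucc _ _ (by simp [Fin.le_def]; omega),
          Fin.succ_last]
      | cast p =>
        rw [Fin.snoc_castSucc, Fin.castSucc_succAbove_castSucc, Fin.castSucc_succAbove_castSucc]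

/-- A contraction of the last two factors of the Adams operation. -/
theorem contractLast_comp_adams (β : N →ₗ[ℂ] N →ₗ[ℂ] ℂ) (hβ : ∀ a b, β a b = β b a)
    (α : Type*) [LinearOrder α] [Fintype α] (n : ℕ) :
    contractLast β n ∘ₗ adams N α (n + 2) = ∑ c : Fin (n + 1) → α,
      sgn (Tuple.sort (c ∘ Fin.castSucc)) • (permute N (Tuple.sort (c ∘ Fin.castSucc)) ∘ₗ
        contract β n ((Tuple.sort c)⁻¹ (Fin.last n))) := by
  ext a
  simp only [LinearMap.compMultilinearMap_apply, LinearMap.comp_apply, LinearMap.sum_apply,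
    LinearMap.smul_apply]
  rw [adams_tprod, map_sum]
  simp only [map_smul]
  -- A symmetric form, like a commutative product, does not see the exchange of the last two
  -- letters, so the same cancellation applies.
  rw [sum_sgn_sort_eq (Fin.last n)
    (fun s => contractLast β n (PiTensorProduct.tprod ℂ fun p => a (s⁻¹ p)))]
  · refine Finset.sum_congr rfl fun c _ => ?_
    obtain ⟨i, hi⟩ : ∃ i, (Tuple.sort c)⁻¹ (Fin.last n) = i := ⟨_, rfl⟩
    have hs := sort_eq_insertPerm_last c i (by rw [← hi, perm_apply_inv])
    rw [hi, contract_tprod, map_smul, permute_tprod, contractLast_tprod]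
    -- Removing the contracted letter from the sorting permutation costs the same sign, and the two
    -- cancel.
    have hsgn : ((-1 : ℂ) ^ ((i : ℕ) + (Fin.last n : Fin (n + 1)))) * sgn (Tuple.sort c) =
        sgn (Tuple.sort (c ∘ Fin.castSucc)) := by
      rw [hs, sgn_insertPerm, ← mul_assoc, ← pow_add, ← two_mul, pow_mul]
      norm_num
    have h1 : (Fin.last n).castSucc = (Fin.last n).succ.succAbove (Fin.last n) := by simp
    have h2 : ∀ p : Fin n, p.castSucc.castSucc = (Fin.last n).succ.succAbove
        ((Fin.last n).succAbove p) := by intro p; simp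
    have h3 : (insertPerm i.succ (Fin.last n).succ (Tuple.sort c))⁻¹ (Fin.last n).castSucc =
        i.castSucc := by
      rw [h1, insertPerm_inv_succAbove, hi]
      simp
    have h4 : (insertPerm i.succ (Fin.last n).succ (Tuple.sort c))⁻¹ (Fin.last (n + 1)) =
        i.succ := insertPerm_inv_self _ _ _
    have h5 : ∀ p : Fin n, (insertPerm i.succ (Fin.last n).succ (Tuple.sort c))⁻¹
        p.castSucc.castSucc =
          i.succ.succAbove (i.succAbove ((Tuple.sort (c ∘ Fin.castSucc))⁻¹ p)) := by
      intro p
      rw [h2, insertPerm_inv_succAbove]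
      congr 1
      conv_lhs => rw [hs]
      rw [insertPerm_inv_succAbove]
    rw [hsgn, h3, h4]
    congr 3
    funext p
    rw [h5]
  · intro s
    have h1 : (swap (Fin.last n).castSucc (Fin.last n).succ * s)⁻¹ (Fin.last n).castSucc =
        s⁻¹ (Fin.last (n + 1)) := by
      rw [mul_inv_rev, Perm.mul_apply, swap_inv, swap_apply_left, Fin.succ_last]
    have h2 : (swap (Fin.last n).castSucc (Fin.last n).succ * s)⁻¹ (Fin.last (n + 1)) =
        s⁻¹ (Fin.last n).castSucc := by
      rw [mul_inv_rev, Perm.mul_apply, swap_inv, ← Fin.succ_last, swap_apply_right]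
    have h3 : ∀ p : Fin n, (swap (Fin.last n).castSucc (Fin.last n).succ * s)⁻¹
        p.castSucc.castSucc = s⁻¹ p.castSucc.castSucc := by
      intro p
      rw [mul_inv_rev, Perm.mul_apply, swap_inv, swap_apply_of_ne_of_ne]
      · simp only [ne_eq, Fin.ext_iff, Fin.val_castSucc, Fin.val_last]; omega
      · simp only [ne_eq, Fin.ext_iff, Fin.val_castSucc, Fin.val_succ, Fin.val_last]; omega
    rw [contractLast_tprod, contractLast_tprod, hβ, h1, h2]
    congr 2
    funext p
    rw [h3]

/-- The last two faces contribute `β(ab,c)` and `β(a,bc)` with opposite signs. -/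
theorem contractLast_comp_d (β : N →ₗ[ℂ] N →ₗ[ℂ] ℂ) (hβ : ∀ a b c, β (a * b) c = β a (b * c))
    (n : ℕ) : contractLast β n ∘ₗ d N (n + 2) = d N n ∘ₗ contractLast β (n + 1) := by
  refine ext_snoc fun v c => ?_
  have h : ((contractLast β n ∘ₗ d N (n + 2) - d N n ∘ₗ contractLast β (n + 1)) ∘ₗ
      (snocEquiv (n + 2)).toLinearMap ∘ₗ (TensorProduct.mk ℂ _ N).flip c) = 0 := by
    refine ext_snoc fun w b => ?_
    have h' : ((contractLast β n ∘ₗ d N (n + 2) - d N n ∘ₗ contractLast β (n + 1)) ∘ₗ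
        (snocEquiv (n + 2)).toLinearMap ∘ₗ (TensorProduct.mk ℂ _ N).flip c) ∘ₗ
        (snocEquiv (n + 1)).toLinearMap ∘ₗ (TensorProduct.mk ℂ _ N).flip b = 0 := by
      refine ext_snoc fun u a => ?_
      simp only [LinearMap.comp_apply, LinearMap.flip_apply, TensorProduct.mk_apply,
        LinearEquiv.coe_coe, snocEquiv_tmul, LinearMap.sub_apply, LinearMap.zero_apply,
        contractLast_snoc_snoc, map_smul, d_snoc_snoc, map_add, snoc_add, snoc_smul, hβ, pow_succ]
      module
    simpa [snocEquiv_tmul] using LinearMap.congr_fun h' w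
  have := LinearMap.congr_fun h v
  simpa [snocEquiv_tmul, sub_eq_zero] using this

/-- Only the last face could spoil this, and `δ` kills it. -/
theorem evalLast_comp_d (δ : N →ₗ[ℂ] ℂ) (hδ : ∀ a b, δ (a * b) = 0) (n : ℕ) :
    evalLast δ n ∘ₗ d N (n + 1) = d N n ∘ₗ evalLast δ (n + 1) := by
  refine ext_snoc fun v c => ?_
  have h : ((evalLast δ n ∘ₗ d N (n + 1) - d N n ∘ₗ evalLast δ (n + 1)) ∘ₗ
      (snocEquiv (n + 1)).toLinearMap ∘ₗ (TensorProduct.mk ℂ _ N).flip c) = 0 := by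
    refine ext_snoc fun u b => ?_
    simp [snocEquiv_tmul, d_snoc_snoc, hδ]
  have := LinearMap.congr_fun h v
  simpa [snocEquiv_tmul, sub_eq_zero] using this

end Contraction

/-! ### The rows of chains: closedness and linear independence of classes -/

section Rows

variable {N : Type*} [NonUnitalCommRing N] [Module ℂ N] [IsScalarTower ℂ N N]
  [SMulCommClass ℂ N N]

open Augmentation

/-- The rows `Pⁿ`, starting from the row `(1, 0)` in degree zero. -/
def row (x r : Fin 2 → N) : (n : ℕ) → Fin 2 → ⨂[ℂ]^n N
  | 0 => ![emptyWord, 0]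
  | n + 1 => fun j => ∑ i : Fin 2, snoc N (row x r n i) (M N x r n i j)

theorem row_succ (x r : Fin 2 → N) (n : ℕ) (j : Fin 2) :
    row x r (n + 1) j = ∑ i : Fin 2, snoc N (row x r n i) (M N x r n i j) := rfl

/-- The first line of `M_0` is `(x₁, x₂)`, so the recursion may start one degree lower and
contraction from degree two makes sense. -/
theorem row_one (x r : Fin 2 → N) (j : Fin 2) : row x r 1 j = snoc N emptyWord (x j) := by
  rw [row_succ, Fin.sum_univ_two]
  fin_cases j <;> simp [row, M, snoc_zero]

theorem P_succ_eq_row (x r : Fin 2 → N) (n : ℕ) : P N x r (n + 1) = row x r (n + 1) := by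
  induction n with
  | zero =>
    funext j
    rw [row_one, snoc_tprod, P]
    congr 1
  | succ n ih =>
    funext j
    rw [P, ih, row_succ]

theorem M_add_two (x r : Fin 2 → N) (n : ℕ) : M N x r (n + 2) = M N x r n := by
  have : Odd (n + 2) ↔ Odd n := by simp [Nat.odd_add]
  simp [M, this]

/-- Consecutive matrices are adjugate to each other, with determinant `∑ xᵢ rᵢ`. -/
theorem sum_M_mul_M (x r : Fin 2 → N) (hxr : ∑ i, x i * r i = 0) (n : ℕ) (i k : Fin 2) :
    ∑ j, M N x r n i j * M N x r (n + 1) j k = 0 := by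
  rw [Fin.sum_univ_two] at hxr ⊢
  have h2 : x 1 * r 1 = - (x 0 * r 0) := by rw [eq_neg_iff_add_eq_zero, add_comm, hxr]
  have e1 := mul_comm (r 0) (x 0)
  have e2 := mul_comm (r 1) (x 1)
  have e3 := mul_comm (r 1) (r 0)
  have e4 := mul_comm (x 1) (x 0)
  have e5 := mul_comm (r 0) (x 1)
  have e6 := mul_comm (r 1) (x 0)
  by_cases hn : Odd n
  · have hn' : ¬ Odd (n + 1) := by simpa [Nat.odd_add_one] using hn
    fin_cases i <;> fin_cases k <;>
      simp [M, hn, hn', e1, e2, e3, e4, e5, e6, h2]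
  · have hn' : Odd (n + 1) := by simpa [Nat.odd_add_one] using hn
    fin_cases i <;> fin_cases k <;>
      simp [M, hn, hn', e1, e2, e3, e4, e5, e6, h2]

theorem d_row (x r : Fin 2 → N) (hxr : ∑ i, x i * r i = 0) (n : ℕ) (j : Fin 2) :
    d N n (row x r (n + 1) j) = 0 := by
  induction n generalizing j with
  | zero => simp [d_zero]
  | succ n ih =>
    have h : ∀ k, d N (n + 1) (snoc N (row x r (n + 1) k) (M N x r (n + 1) k j)) =
        (-1 : ℂ) ^ n • ∑ i, snoc N (row x r n i) (M N x r n i k * M N x r (n + 1) k j) := by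
      intro k
      have h1 : snoc N (d N n (row x r (n + 1) k)) (M N x r (n + 1) k j) = 0 := by
        rw [ih, snoc_zero]
      conv_lhs => rw [row_succ, snoc_sum, map_sum]
      rw [row_succ, map_sum, snoc_sum] at h1
      simp only [d_snoc_snoc]
      rw [Finset.sum_add_distrib, h1, zero_add, Finset.smul_sum]
    rw [row_succ, map_sum, Finset.sum_congr rfl fun k _ => h k, ← Finset.smul_sum, Finset.sum_comm]
    simp only [← snoc_sum_right, sum_M_mul_M x r hxr, snoc_zero_right, Finset.sum_const_zero,
      smul_zero]

theorem row_mem_cycles (x r : Fin 2 → N) (hxr : ∑ i, x i * r i = 0) (n : ℕ) (j : Fin 2) :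
    row x r n j ∈ cycles N n := by
  cases n with
  | zero => trivial
  | succ n => exact d_row x r hxr n j

/-- Cocycles which detect the classes of the rows. -/
structure Detector (x r : Fin 2 → N) where
  form : N →ₗ[ℂ] N →ₗ[ℂ] ℂ
  form_symm : ∀ a b, form a b = form b a
  form_mul : ∀ a b c, form (a * b) c = form a (b * c)
  form_rel : ∑ i, form (x i) (r i) = 1
  lin : Fin 2 → N →ₗ[ℂ] ℂ
  lin_mul : ∀ i a b, lin i (a * b) = 0
  lin_coord : ∀ i j, lin i (x j) = if i = j then 1 else 0
  rel : ∑ i, x i * r i = 0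

namespace Detector

variable {x r : Fin 2 → N} (D : Detector x r)

/-- The adjugate identity again, with the form in place of the product: symmetry cancels off the
diagonal, and `form_rel` gives 1 on it. -/
theorem sum_form_M (n : ℕ) (i k : Fin 2) :
    ∑ j, D.form (M N x r n i j) (M N x r (n + 1) j k) = if i = k then 1 else 0 := by
  have h := D.form_rel
  rw [Fin.sum_univ_two] at h ⊢
  have h' : D.form (x 1) (r 1) = 1 - D.form (x 0) (r 0) := by rw [← h]; ring
  have e1 := D.form_symm (r 0) (x 0)
  have e2 := D.form_symm (r 1) (x 1)
  have e3 := D.form_symm (r 1) (r 0)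
  have e4 := D.form_symm (x 1) (x 0)
  have e5 := D.form_symm (r 0) (x 1)
  have e6 := D.form_symm (r 1) (x 0)
  by_cases hn : Odd n
  · have hn' : ¬ Odd (n + 1) := by simpa [Nat.odd_add_one] using hn
    fin_cases i <;> fin_cases k <;>
      simp [M, hn, hn', e1, e2, e3, e4, e5, e6, h']
  · have hn' : Odd (n + 1) := by simpa [Nat.odd_add_one] using hn
    fin_cases i <;> fin_cases k <;>
      simp [M, hn, hn', e1, e2, e3, e4, e5, e6, h']

theorem contractLast_row (n : ℕ) (j : Fin 2) :
    contractLast D.form n (row x r (n + 2) j) = row x r n j := by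
  have h : row x r (n + 2) j = ∑ k, ∑ i, snoc N (snoc N (row x r n i) (M N x r n i k))
      (M N x r (n + 1) k j) := by
    rw [row_succ]
    exact Finset.sum_congr rfl fun k _ => by rw [row_succ, snoc_sum]
  rw [h]
  simp only [map_sum, contractLast_snoc_snoc]
  rw [Finset.sum_comm]
  simp only [← Finset.sum_smul, D.sum_form_M]
  simp

/-- Contracting in the middle removes two consecutive matrices; the remaining ones fit together
because they have period two. -/
theorem contract_row (n : ℕ) (i : Fin (n + 1)) (j : Fin 2) :
    contract D.form n i (row x r (n + 2) j) = row x r n j := by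
  induction n generalizing j with
  | zero =>
    rw [show i = Fin.last 0 from Fin.ext (by omega), contract_last]
    exact D.contractLast_row 0 j
  | succ n ih =>
    induction i using Fin.lastCases with
    | last => rw [contract_last, D.contractLast_row]
    | cast i =>
      rw [row_succ, map_sum]
      simp only [contract_castSucc_snoc, ih]
      rw [row_succ, M_add_two]

/-- After contraction the last colour affects only the place of the contracted pair, which by
`contract_row` is irrelevant. Its `m` values give the factor. -/
theorem contractLast_adams_row (m n : ℕ) (j : Fin 2) :
    contractLast D.form n (adams N (Fin m) (n + 2) (row x r (n + 2) j)) =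
      (m : ℂ) • adams N (Fin m) n (row x r n j) := by
  have := LinearMap.congr_fun (contractLast_comp_adams D.form D.form_symm (Fin m) n)
    (row x r (n + 2) j)
  rw [LinearMap.comp_apply] at this
  rw [this]
  simp only [LinearMap.sum_apply, LinearMap.smul_apply, LinearMap.comp_apply, D.contract_row]
  rw [adams]
  simp only [LinearMap.sum_apply, LinearMap.smul_apply]
  rw [← (Fin.snocEquiv fun _ : Fin (n + 1) => Fin m).sum_comp, Fintype.sum_prod_type]
  have hc : ∀ (y : Fin m) (c : Fin n → Fin m),
      (Fin.snocEquiv fun _ : Fin (n + 1) => Fin m) (y, c) ∘ Fin.castSucc = c := by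
    intro y c
    funext p
    simp [Fin.snocEquiv]
  simp only [hc, Finset.sum_const, Finset.card_univ, Fintype.card_fin, Nat.cast_smul_eq_nsmul]

theorem contractLast_mem_boundaries {n : ℕ} {z : ⨂[ℂ]^(n + 2) N} (hz : z ∈ boundaries N (n + 2)) :
    contractLast D.form n z ∈ boundaries N n := by
  obtain ⟨w, rfl⟩ := hz
  exact ⟨contractLast D.form (n + 1) w,
    (LinearMap.congr_fun (contractLast_comp_d D.form D.form_mul n) w).symm⟩

theorem evalLast_mem_boundaries (i : Fin 2) {n : ℕ} {z : ⨂[ℂ]^(n + 1) N}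
    (hz : z ∈ boundaries N (n + 1)) : evalLast (D.lin i) n z ∈ boundaries N n := by
  obtain ⟨w, rfl⟩ := hz
  exact ⟨evalLast (D.lin i) (n + 1) w,
    (LinearMap.congr_fun (evalLast_comp_d (D.lin i) (D.lin_mul i) n) w).symm⟩

theorem emptyWord_ne_zero : (emptyWord : ⨂[ℂ]^0 N) ≠ 0 := by
  intro h
  have := congrArg (PiTensorProduct.isEmptyEquiv (R := ℂ) (s := fun _ : Fin 0 => N) (Fin 0)) h
  simp [emptyWord] at this

theorem boundaries_zero : boundaries N 0 = ⊥ := by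
  rw [boundaries, d_zero, LinearMap.range_zero]

/-- Contraction descends by two degrees. In degree one the linear forms separate the coordinates, as
nonzero chains there are not exact. -/
theorem eq_zero_of_sum_mem (D : Detector x r) (n : ℕ) (l : Fin 2 → ℂ)
    (h : ∑ j, l j • row x r (n + 1) j ∈ boundaries N (n + 1)) : l = 0 := by
  have h1 : ∀ l : Fin 2 → ℂ, ∑ j, l j • row x r 1 j ∈ boundaries N 1 → l = 0 := by
    intro l h
    funext i
    have := D.evalLast_mem_boundaries i h
    rw [boundaries_zero, Submodule.mem_bot] at this
    simp only [map_sum, map_smul, row_one, evalLast_snoc, D.lin_coord] at this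
    simpa [emptyWord_ne_zero] using this
  induction n using Nat.twoStepInduction generalizing l with
  | zero => exact h1 l h
  | one =>
    -- In degree two the contraction ends at `(1, 0)` and sees only the first coefficient; a linear
    -- form recovers the second.
    have h0 := D.contractLast_mem_boundaries h
    rw [boundaries_zero, Submodule.mem_bot] at h0
    simp only [map_sum, map_smul, D.contractLast_row] at h0
    have hl0 : l 0 = 0 := by simpa [row, Fin.sum_univ_two, emptyWord_ne_zero] using h0
    have h2 := D.evalLast_mem_boundaries 0 h
    have h3 : evalLast (D.lin 0) 1 (row x r 2 1) = row x r 1 1 := by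
      rw [row_succ]
      simp [Fin.sum_univ_two, M, D.lin_coord]
    have h4 := h1 ![0, l 1] (by simpa [Fin.sum_univ_two, hl0, h3] using h2)
    have h5 : l 1 = 0 := by simpa using congrFun h4 1
    funext i
    fin_cases i
    · exact hl0
    · exact h5
  | more n ih _ =>
    refine ih l ?_
    have := D.contractLast_mem_boundaries h
    simpa only [map_sum, map_smul, D.contractLast_row] using this

end Detector

end Rows

end PlaneCurve
end

noncomputable section

set_option linter.unusedSectionVars false
set_option linter.unusedSimpArgs false

namespace PlaneCurve

/-! ### Homology of the components as direct summands -/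

section Components

variable {N : Type*} [NonUnitalCommRing N] [Module ℂ N] [IsScalarTower ℂ N N]
  [SMulCommClass ℂ N N]

theorem e_e (n j k : ℕ) (z : ⨂[ℂ]^n N) : e N n j (e N n k z) = if j = k then e N n k z else 0 := by
  have := LinearMap.congr_fun (e_comp_e N n j k) z
  rw [LinearMap.comp_apply] at this
  rw [this]
  split_ifs <;> rfl

theorem e_e_self (n k : ℕ) (z : ⨂[ℂ]^n N) : e N n k (e N n k z) = e N n k z := by
  rw [e_e, if_pos rfl]

theorem d_e (n k : ℕ) (z : ⨂[ℂ]^(n + 1) N) : d N n (e N (n + 1) k z) = e N n k (d N n z) :=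
  LinearMap.congr_fun (d_comp_e N n k) z

theorem e_mem_boundaries {n : ℕ} (k : ℕ) {z : ⨂[ℂ]^n N} (hz : z ∈ boundaries N n) :
    e N n k z ∈ boundaries N n := by
  obtain ⟨w, rfl⟩ := hz
  exact ⟨_, d_e n k w⟩

theorem e_mem_cycles {n : ℕ} (k : ℕ) {z : ⨂[ℂ]^n N} (hz : z ∈ cycles N n) :
    e N n k z ∈ cycles N n := by
  cases n with
  | zero => trivial
  | succ n =>
    have hz' : d N n z = 0 := hz
    change d N n _ = 0
    rw [d_e, hz', map_zero]

theorem adams_mem_cycles (M : ℕ) {n : ℕ} {z : ⨂[ℂ]^n N} (hz : z ∈ cycles N n) :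
    adams N (Fin M) n z ∈ cycles N n := by
  cases n with
  | zero => trivial
  | succ n =>
    have hz' : d N n z = 0 := hz
    change (d N n ∘ₗ adams N (Fin M) (n + 1)) z = 0
    rw [d_comp_adams, LinearMap.comp_apply, hz', map_zero]

theorem mem_comp {n k : ℕ} {z : ⨂[ℂ]^n N} : z ∈ comp N n k ↔ e N n k z = z :=
  ⟨by rintro ⟨w, rfl⟩; exact e_e_self n k w, fun h => ⟨z, h⟩⟩

theorem mem_boundariesComp {n k : ℕ} {z : ⨂[ℂ]^n N} :
    z ∈ boundariesComp N n k ↔ z ∈ boundaries N n ∧ e N n k z = z := by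
  constructor
  · rintro ⟨_, ⟨w, rfl⟩, rfl⟩
    exact ⟨⟨_, rfl⟩, by rw [d_e, e_e_self]⟩
  · rintro ⟨⟨w, rfl⟩, h⟩
    exact ⟨e N (n + 1) k w, ⟨w, rfl⟩, by rw [d_e, h]⟩

theorem e_mem_cyclesComp {n : ℕ} (k : ℕ) {z : ⨂[ℂ]^n N} (hz : z ∈ cycles N n) :
    e N n k z ∈ cyclesComp N n k :=
  ⟨e_mem_cycles k hz, ⟨z, rfl⟩⟩

theorem hochClass_eq_iff {n : ℕ} {z w : ⨂[ℂ]^n N} (hz : z ∈ cycles N n) (hw : w ∈ cycles N n) :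
    hochClass N n z hz = hochClass N n w hw ↔ z - w ∈ boundaries N n :=
  Submodule.Quotient.eq _

theorem compClass_eq_iff {n k : ℕ} {z w : ⨂[ℂ]^n N} (hz : z ∈ cyclesComp N n k)
    (hw : w ∈ cyclesComp N n k) :
    compClass N n k z hz = compClass N n k w hw ↔ z - w ∈ boundaries N n := by
  have h1 : compClass N n k z hz = compClass N n k w hw ↔ z - w ∈ boundariesComp N n k :=
    Submodule.Quotient.eq _
  rw [h1, mem_boundariesComp, and_iff_left]
  rw [map_sub, mem_comp.1 hz.2, mem_comp.1 hw.2]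

theorem toHoch_compClass {n k : ℕ} {z : ⨂[ℂ]^n N} (hz : z ∈ cyclesComp N n k) :
    toHoch N n k (compClass N n k z hz) = hochClass N n z hz.1 := rfl

theorem exists_compClass {n k : ℕ} (q : HComp N n k) :
    ∃ (z : ⨂[ℂ]^n N) (hz : z ∈ cyclesComp N n k), compClass N n k z hz = q := by
  obtain ⟨⟨z, hz⟩, rfl⟩ := Submodule.Quotient.mk_surjective _ q
  exact ⟨z, hz, rfl⟩

theorem exists_hochClass {n : ℕ} (q : Hoch N n) :
    ∃ (z : ⨂[ℂ]^n N) (hz : z ∈ cycles N n), hochClass N n z hz = q := by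
  obtain ⟨⟨z, hz⟩, rfl⟩ := Submodule.Quotient.mk_surjective _ q
  exact ⟨z, hz, rfl⟩

/-- If `z = e z` is exact, `z = d w`, then `z = d (e w)` is exact inside the component. -/
theorem toHoch_injective (n k : ℕ) : Function.Injective (toHoch N n k) := by
  intro p q h
  obtain ⟨z, hz, rfl⟩ := exists_compClass p
  obtain ⟨w, hw, rfl⟩ := exists_compClass q
  rw [toHoch_compClass, toHoch_compClass, hochClass_eq_iff] at h
  exact (compClass_eq_iff hz hw).2 h

theorem subsingleton_hComp {n k : ℕ} (h : ∀ z ∈ cycles N n, e N n k z ∈ boundaries N n) :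
    Subsingleton (HComp N n k) := by
  refine ⟨fun p q => ?_⟩
  obtain ⟨z, hz, rfl⟩ := exists_compClass p
  obtain ⟨w, hw, rfl⟩ := exists_compClass q
  rw [compClass_eq_iff, ← mem_comp.1 hz.2, ← mem_comp.1 hw.2]
  exact Submodule.sub_mem _ (h z hz.1) (h w hw.1)

/-- A closed chain which is not exact and spans the closed chains modulo exact ones gives a
basis of the homology of a component. -/
theorem exists_basis_hComp {n k : ℕ} {v : ⨂[ℂ]^n N} (hv : v ∈ cyclesComp N n k)
    (h0 : v ∉ boundaries N n)
    (hs : ∀ z ∈ cyclesComp N n k, ∃ c : ℂ, z - c • v ∈ boundaries N n) :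
    ∃ b : Module.Basis (Fin 1) ℂ (HComp N n k), b 0 = compClass N n k v hv := by
  have hne : compClass N n k v hv ≠ 0 := by
    intro h
    have := (compClass_eq_iff hv (Submodule.zero_mem _)).1 h
    rw [sub_zero] at this
    exact h0 this
  refine ⟨Module.Basis.mk (v := fun _ : Fin 1 => compClass N n k v hv) ?_ ?_, ?_⟩
  · rw [linearIndependent_unique_iff]
    exact hne
  · rintro q -
    obtain ⟨z, hz, rfl⟩ := exists_compClass q
    obtain ⟨c, hc⟩ := hs z hz
    have : compClass N n k z hz = c • compClass N n k v hv :=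
      (compClass_eq_iff hz (Submodule.smul_mem _ c hv)).2 hc
    rw [this]
    exact Submodule.smul_mem _ _ (Submodule.subset_span ⟨0, rfl⟩)
  · rw [Module.Basis.mk_apply]

/-- The idempotents on an eigenvector of the Adams operations modulo a submodule. -/
theorem e_sub_mem_of_adams {n : ℕ} (W : Submodule ℂ (⨂[ℂ]^n N)) (v : ⨂[ℂ]^n N) (p : ℕ)
    (h : ∀ M : ℕ, adams N (Fin M) n v - (M : ℂ) ^ p • v ∈ W) (k : ℕ) :
    e N n k v - (if k = p then v else 0) ∈ W := by
  -- The cut-off exceeds `n`, `p` and `k`, so that every relevant power of `M` is compared.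
  have key := eq_of_sum_pow_smul (n + p + k + 1) (fun k => W.mkQ (e N n k v))
    (fun k => W.mkQ (if k = p then v else 0)) (fun M => ?_) k (by omega)
  · rw [← Submodule.ker_mkQ W, LinearMap.mem_ker, map_sub, sub_eq_zero]
    exact key
  · have h1 : W.mkQ (adams N (Fin M) n v) = W.mkQ ((M : ℂ) ^ p • v) := by
      rw [← sub_eq_zero, ← map_sub, ← LinearMap.mem_ker, Submodule.ker_mkQ]
      exact h M
    rw [← sum_pow_smul_e N n M (n + p + k + 1) (by omega), LinearMap.sum_apply, map_sum] at h1
    simp only [LinearMap.smul_apply, map_smul] at h1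
    rw [h1, Finset.sum_eq_single p]
    · rw [if_pos rfl]
    · intro j _ hj
      rw [if_neg hj, map_zero, smul_zero]
    · intro hp
      exact absurd (Finset.mem_range.2 (by omega)) hp

end Components

/-! ### Eigenvalues of the Adams operations on the rows -/

namespace Detector

variable {N : Type*} [NonUnitalCommRing N] [Module ℂ N] [IsScalarTower ℂ N N]
  [SMulCommClass ℂ N N] {x r : Fin 2 → N}

theorem exists_basis_hoch (D : Detector x r) (n : ℕ) (hfin : Module.Finite ℂ (Hoch N (n + 1)))
    (hrank : Module.finrank ℂ (Hoch N (n + 1)) ≤ 2) :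
    ∃ b : Module.Basis (Fin 2) ℂ (Hoch N (n + 1)),
      ∀ i, b i = hochClass N (n + 1) (row x r (n + 1) i) (row_mem_cycles x r D.rel (n + 1) i) := by
  have hli : LinearIndependent ℂ fun i => hochClass N (n + 1) (row x r (n + 1) i)
      (row_mem_cycles x r D.rel (n + 1) i) := by
    rw [Fintype.linearIndependent_iff]
    intro g hg
    refine fun i => congrFun (D.eq_zero_of_sum_mem n g ?_) i
    have h1 : Submodule.mkQ ((boundaries N (n + 1)).submoduleOf (cycles N (n + 1)))
        (∑ i, g i • ⟨row x r (n + 1) i, row_mem_cycles x r D.rel (n + 1) i⟩) = 0 := by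
      rw [← hg, map_sum]
      rfl
    rw [← LinearMap.mem_ker, Submodule.ker_mkQ] at h1
    have h2 : ((∑ i, g i • ⟨row x r (n + 1) i, row_mem_cycles x r D.rel (n + 1) i⟩ :
        cycles N (n + 1)) : ⨂[ℂ]^(n + 1) N) ∈ boundaries N (n + 1) := h1
    simpa using h2
  have hcard : Fintype.card (Fin 2) = Module.finrank ℂ (Hoch N (n + 1)) :=
    le_antisymm hli.fintype_card_le_finrank (by simpa using hrank)
  exact ⟨basisOfLinearIndependentOfCardEqFinrank hli hcard, fun i => by
    rw [coe_basisOfLinearIndependentOfCardEqFinrank]⟩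

theorem exists_sub_sum_mem (D : Detector x r) (hfin : ∀ n, Module.Finite ℂ (Hoch N (n + 1)) ∧
    Module.finrank ℂ (Hoch N (n + 1)) ≤ 2) (n : ℕ) (z : ⨂[ℂ]^(n + 1) N)
    (hz : z ∈ cycles N (n + 1)) :
    ∃ a b : ℂ, z - (a • row x r (n + 1) 0 + b • row x r (n + 1) 1) ∈ boundaries N (n + 1) := by
  obtain ⟨b, hb⟩ := D.exists_basis_hoch n (hfin n).1 (hfin n).2
  have h := b.sum_repr (hochClass N (n + 1) z hz)
  rw [Fin.sum_univ_two, hb, hb] at h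
  refine ⟨_, _, (hochClass_eq_iff hz ?_).1 h.symm⟩
  exact Submodule.add_mem _ (Submodule.smul_mem _ _ (row_mem_cycles x r D.rel _ _))
    (Submodule.smul_mem _ _ (row_mem_cycles x r D.rel _ _))

/-- Contraction takes a basis of homology to independent classes, so it is injective on homology;
congruences modulo exact chains can be checked two degrees lower. -/
theorem mem_boundaries_of_contractLast (D : Detector x r)
    (hfin : ∀ n, Module.Finite ℂ (Hoch N (n + 1)) ∧ Module.finrank ℂ (Hoch N (n + 1)) ≤ 2)
    (n : ℕ) (z : ⨂[ℂ]^(n + 3) N) (hz : z ∈ cycles N (n + 3))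
    (h : contractLast D.form (n + 1) z ∈ boundaries N (n + 1)) : z ∈ boundaries N (n + 3) := by
  obtain ⟨a, b, hab⟩ := D.exists_sub_sum_mem hfin (n + 2) z hz
  have h1 := D.contractLast_mem_boundaries hab
  have h2 := Submodule.sub_mem _ h h1
  simp only [map_sub, map_add, map_smul, D.contractLast_row, sub_sub_cancel] at h2
  have h3 := D.eq_zero_of_sum_mem n ![a, b] (by simpa [Fin.sum_univ_two] using h2)
  have ha : a = 0 := by simpa using congrFun h3 0
  have hb : b = 0 := by simpa using congrFun h3 1
  simpa [ha, hb] using hab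

theorem adams_row_one (M : ℕ) (j : Fin 2) :
    adams N (Fin M) 1 (row x r 1 j) = (M : ℂ) • row x r 1 j := by
  have : ∀ c : Fin 1 → Fin M, Tuple.sort c = 1 := fun c => Subsingleton.elim _ _
  simp [adams, this, sgn, permute_one, Nat.cast_smul_eq_nsmul]

theorem permute_row_two (s : Equiv.Perm (Fin 2)) :
    permute N s (row x r 2 1) = sgn s • row x r 2 1 := by
  have hrow : row x r 2 1 = PiTensorProduct.tprod ℂ ![x 1, x 0] -
      PiTensorProduct.tprod ℂ ![x 0, x 1] := by
    have h : ∀ a b : N, snoc N (snoc N Augmentation.emptyWord a) b =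
        PiTensorProduct.tprod ℂ ![a, b] := by
      intro a b
      rw [snoc_tprod, snoc_tprod]
      congr 1
      funext i
      fin_cases i
      · rfl
      · rfl
    rw [row_succ, Fin.sum_univ_two, row_one, row_one]
    simp only [M, Nat.odd_iff, Nat.one_mod, if_true, Matrix.of_apply, Matrix.cons_val', Matrix.cons_val_zero,
      Matrix.cons_val_one, Matrix.cons_val_fin_one, snoc_neg_right]
    rw [h, h]
    abel
  have hs : ∀ s : Equiv.Perm (Fin 2), s = 1 ∨ s = Equiv.swap 0 1 := by decide
  rcases hs s with rfl | rfl
  · simp [permute_one, sgn]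
  · have hp : ∀ a b : N, permute N (Equiv.swap (0 : Fin 2) 1) (PiTensorProduct.tprod ℂ ![a, b]) =
        PiTensorProduct.tprod ℂ ![b, a] := by
      intro a b
      rw [permute_tprod]
      congr 1
      funext i
      fin_cases i <;> simp
    rw [hrow, map_sub, hp, hp]
    simp [sgn]

/-- The chain is antisymmetric, so each of the `M ^ 2` colourings contributes the chain itself. -/
theorem adams_row_two (M : ℕ) :
    adams N (Fin M) 2 (row x r 2 1) = (M : ℂ) ^ 2 • row x r 2 1 := by
  have hss : ∀ s : Equiv.Perm (Fin 2), sgn s * sgn s = 1 := by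
    intro s
    rcases Int.units_eq_one_or (Equiv.Perm.sign s) with h | h <;> simp [sgn, h]
  simp only [adams, LinearMap.sum_apply, LinearMap.smul_apply, permute_row_two, smul_smul, hss,
    one_smul, Finset.sum_const, Finset.card_univ, Fintype.card_fun, Fintype.card_fin]
  rw [← Nat.cast_smul_eq_nsmul ℂ]
  push_cast
  rfl

theorem adams_zero (M : ℕ) : adams N (Fin M) 0 = LinearMap.id := by
  have : ∀ c : Fin 0 → Fin M, Tuple.sort c = 1 := fun c => Subsingleton.elim _ _
  simp [adams, this, sgn, permute_one]

theorem adams_row_add_two (D : Detector x r)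
    (hfin : ∀ n, Module.Finite ℂ (Hoch N (n + 1)) ∧ Module.finrank ℂ (Hoch N (n + 1)) ≤ 2)
    (M n p : ℕ) (c : ℂ) (j : Fin 2)
    (h : adams N (Fin M) (n + 1) (row x r (n + 1) j) - (M : ℂ) ^ p • row x r (n + 1) j -
      c • row x r (n + 1) 1 ∈ boundaries N (n + 1)) :
    adams N (Fin M) (n + 3) (row x r (n + 3) j) - (M : ℂ) ^ (p + 1) • row x r (n + 3) j -
      ((M : ℂ) * c) • row x r (n + 3) 1 ∈ boundaries N (n + 3) := by
  refine D.mem_boundaries_of_contractLast hfin n _ (Submodule.sub_mem _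
    (Submodule.sub_mem _ (adams_mem_cycles M (row_mem_cycles x r D.rel _ _))
    (Submodule.smul_mem _ _ (row_mem_cycles x r D.rel _ _)))
    (Submodule.smul_mem _ _ (row_mem_cycles x r D.rel _ _))) ?_
  have := Submodule.smul_mem _ (M : ℂ) h
  rw [smul_sub, smul_sub, smul_smul, smul_smul, ← pow_succ'] at this
  rw [map_sub, map_sub, map_smul, map_smul, D.contractLast_adams_row M (n + 1) j,
    D.contractLast_row (n + 1) j, D.contractLast_row (n + 1) 1]
  exact this

theorem adams_row_odd (D : Detector x r)
    (hfin : ∀ n, Module.Finite ℂ (Hoch N (n + 1)) ∧ Module.finrank ℂ (Hoch N (n + 1)) ≤ 2)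
    (M k : ℕ) (j : Fin 2) :
    adams N (Fin M) (2 * k + 1) (row x r (2 * k + 1) j) - (M : ℂ) ^ (k + 1) •
      row x r (2 * k + 1) j ∈ boundaries N (2 * k + 1) := by
  induction k with
  | zero => simp [adams_row_one]
  | succ k ih =>
    rw [show 2 * (k + 1) + 1 = 2 * k + 3 by ring]
    simpa using D.adams_row_add_two hfin M (2 * k) (k + 1) 0 j (by simpa using ih)

theorem adams_row_even_one (D : Detector x r)
    (hfin : ∀ n, Module.Finite ℂ (Hoch N (n + 1)) ∧ Module.finrank ℂ (Hoch N (n + 1)) ≤ 2)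
    (M k : ℕ) :
    adams N (Fin M) (2 * k + 2) (row x r (2 * k + 2) 1) - (M : ℂ) ^ (k + 2) •
      row x r (2 * k + 2) 1 ∈ boundaries N (2 * k + 2) := by
  induction k with
  | zero => simp [adams_row_two]
  | succ k ih =>
    rw [show 2 * (k + 1) + 2 = 2 * k + 1 + 3 by ring]
    simpa using D.adams_row_add_two hfin M (2 * k + 1) (k + 2) 0 1 (by simpa using ih)

theorem adams_row_even_zero (D : Detector x r)
    (hfin : ∀ n, Module.Finite ℂ (Hoch N (n + 1)) ∧ Module.finrank ℂ (Hoch N (n + 1)) ≤ 2)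
    (M k : ℕ) :
    ∃ c : ℂ, adams N (Fin M) (2 * k + 2) (row x r (2 * k + 2) 0) - (M : ℂ) ^ (k + 1) •
      row x r (2 * k + 2) 0 - c • row x r (2 * k + 2) 1 ∈ boundaries N (2 * k + 2) := by
  induction k with
  | zero =>
    obtain ⟨a, b, hab⟩ := D.exists_sub_sum_mem hfin 1 (adams N (Fin M) 2 (row x r 2 0))
      (adams_mem_cycles M (row_mem_cycles x r D.rel _ _))
    -- In degree zero `ψ^M` is the identity, which fixes the leading coefficient as `M`; the second
    -- row contracts to zero, so its coefficient stays undetermined.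
    have h := D.contractLast_mem_boundaries hab
    rw [boundaries_zero, Submodule.mem_bot] at h
    simp only [map_sub, map_add, map_smul, D.contractLast_row, D.contractLast_adams_row,
      adams_zero, LinearMap.id_apply] at h
    have ha : (M : ℂ) = a := by
      simpa [row, ← sub_smul, emptyWord_ne_zero, sub_eq_zero] using h
    refine ⟨b, ?_⟩
    rw [sub_sub, ha, zero_add, pow_one]
    exact hab
  | succ k ih =>
    obtain ⟨c, hc⟩ := ih
    refine ⟨(M : ℂ) * c, ?_⟩
    rw [show 2 * (k + 1) + 2 = 2 * k + 1 + 3 by ring]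
    exact D.adams_row_add_two hfin M (2 * k + 1) (k + 1) c 0 hc

end Detector

end PlaneCurve
end

noncomputable section

set_option linter.unusedSectionVars false
set_option linter.unusedSimpArgs false

namespace PlaneCurve

/-! ### Decomposition of the homology in odd and even degrees -/

namespace Detector

variable {N : Type*} [NonUnitalCommRing N] [Module ℂ N] [IsScalarTower ℂ N N]
  [SMulCommClass ℂ N N] {x r : Fin 2 → N}

theorem e_row_odd (D : Detector x r)
    (hfin : ∀ n, Module.Finite ℂ (Hoch N (n + 1)) ∧ Module.finrank ℂ (Hoch N (n + 1)) ≤ 2)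
    (k i : ℕ) (j : Fin 2) :
    e N (2 * k + 1) i (row x r (2 * k + 1) j) - (if i = k + 1 then row x r (2 * k + 1) j else 0) ∈
      boundaries N (2 * k + 1) :=
  e_sub_mem_of_adams _ _ (k + 1) (fun M => D.adams_row_odd hfin M k j) i

theorem e_odd (D : Detector x r)
    (hfin : ∀ n, Module.Finite ℂ (Hoch N (n + 1)) ∧ Module.finrank ℂ (Hoch N (n + 1)) ≤ 2)
    (k i : ℕ) (z : ⨂[ℂ]^(2 * k + 1) N) (hz : z ∈ cycles N (2 * k + 1)) :
    e N (2 * k + 1) i z - (if i = k + 1 then z else 0) ∈ boundaries N (2 * k + 1) := by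
  obtain ⟨a, b, hab⟩ := D.exists_sub_sum_mem hfin (2 * k) z hz
  have h0 := Submodule.smul_mem _ a (D.e_row_odd hfin k i 0)
  have h1 := Submodule.smul_mem _ b (D.e_row_odd hfin k i 1)
  have h2 := e_mem_boundaries i hab
  simp only [map_sub, map_add, map_smul] at h2
  split_ifs at h0 h1 ⊢ with hi
  · have := Submodule.sub_mem _ (Submodule.add_mem _ h2 (Submodule.add_mem _ h0 h1)) hab
    convert this using 1
    module
  · have := Submodule.add_mem _ h2 (Submodule.add_mem _ h0 h1)
    convert this using 1
    module

/-- The decomposition in odd degrees. -/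
theorem odd_decomposition (D : Detector x r)
    (hfin : ∀ n, Module.Finite ℂ (Hoch N (n + 1)) ∧ Module.finrank ℂ (Hoch N (n + 1)) ≤ 2)
    (k : ℕ) :
    (Function.Bijective (toHoch N (2 * k + 1) (k + 1)) ∧
      Module.finrank ℂ (HComp N (2 * k + 1) (k + 1)) = 2 ∧
      ∀ j, j ≠ k + 1 → Subsingleton (HComp N (2 * k + 1) j)) ∧
    ∃ (h : ∀ i, e N (2 * k + 1) (k + 1) (row x r (2 * k + 1) i) ∈
        cyclesComp N (2 * k + 1) (k + 1))
      (b : Module.Basis (Fin 2) ℂ (HComp N (2 * k + 1) (k + 1))),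
      ∀ i, b i = compClass N (2 * k + 1) (k + 1) _ (h i) := by
  have hbij : Function.Bijective (toHoch N (2 * k + 1) (k + 1)) := by
    refine ⟨toHoch_injective _ _, fun q => ?_⟩
    obtain ⟨z, hz, rfl⟩ := exists_hochClass q
    refine ⟨compClass N _ _ _ (e_mem_cyclesComp (k + 1) hz), ?_⟩
    rw [toHoch_compClass, hochClass_eq_iff]
    simpa using D.e_odd hfin k (k + 1) z hz
  obtain ⟨b, hb⟩ := D.exists_basis_hoch (2 * k) (hfin _).1 (hfin _).2
  let b' := b.map (LinearEquiv.ofBijective _ hbij).symm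
  have hmem : ∀ i, e N (2 * k + 1) (k + 1) (row x r (2 * k + 1) i) ∈
      cyclesComp N (2 * k + 1) (k + 1) := fun i =>
    e_mem_cyclesComp _ (row_mem_cycles x r D.rel _ _)
  refine ⟨⟨hbij, ?_, fun j hj => ?_⟩, hmem, b', fun i => ?_⟩
  · rw [Module.finrank_eq_card_basis b', Fintype.card_fin]
  · refine subsingleton_hComp fun z hz => ?_
    simpa [hj] using D.e_odd hfin k j z hz
  · apply hbij.1
    rw [toHoch_compClass]
    have h1 : toHoch N (2 * k + 1) (k + 1) (b' i) = b i :=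
      (LinearEquiv.ofBijective _ hbij).apply_symm_apply (b i)
    rw [h1, hb, hochClass_eq_iff]
    have := Submodule.neg_mem _ (D.e_odd hfin k (k + 1) _ (row_mem_cycles x r D.rel _ i))
    simpa using this

theorem e_row_even_one (D : Detector x r)
    (hfin : ∀ n, Module.Finite ℂ (Hoch N (n + 1)) ∧ Module.finrank ℂ (Hoch N (n + 1)) ≤ 2)
    (k i : ℕ) :
    e N (2 * k + 2) i (row x r (2 * k + 2) 1) - (if i = k + 2 then row x r (2 * k + 2) 1 else 0) ∈
      boundaries N (2 * k + 2) :=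
  e_sub_mem_of_adams _ _ (k + 2) (fun M => D.adams_row_even_one hfin M k) i

theorem e_row_even_zero (D : Detector x r)
    (hfin : ∀ n, Module.Finite ℂ (Hoch N (n + 1)) ∧ Module.finrank ℂ (Hoch N (n + 1)) ≤ 2)
    (k i : ℕ) :
    ∃ c : ℂ, e N (2 * k + 2) i (row x r (2 * k + 2) 0) -
      (if i = k + 1 then row x r (2 * k + 2) 0 else 0) - c • row x r (2 * k + 2) 1 ∈
      boundaries N (2 * k + 2) := by
  -- The first row is an eigenvector only modulo the second, so the latter is added to the exact
  -- chains.
  have h := e_sub_mem_of_adams (boundaries N (2 * k + 2) ⊔ ℂ ∙ row x r (2 * k + 2) 1)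
    (row x r (2 * k + 2) 0) (k + 1) (fun M => by
      obtain ⟨c, hc⟩ := D.adams_row_even_zero hfin M k
      exact Submodule.mem_sup.2 ⟨_, hc, _, Submodule.smul_mem _ c
        (Submodule.mem_span_singleton_self _), by abel⟩) i
  obtain ⟨y, hy, z, hz, hyz⟩ := Submodule.mem_sup.1 h
  obtain ⟨c, rfl⟩ := Submodule.mem_span_singleton.1 hz
  exact ⟨c, by rw [← hyz]; simpa using hy⟩

/-- On the homology in even degrees, the idempotent of index `k + 2` is a projection to the span
of the second row. -/
theorem e_even_top (D : Detector x r)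
    (hfin : ∀ n, Module.Finite ℂ (Hoch N (n + 1)) ∧ Module.finrank ℂ (Hoch N (n + 1)) ≤ 2)
    (k : ℕ) (z : ⨂[ℂ]^(2 * k + 2) N) (hz : z ∈ cycles N (2 * k + 2)) :
    ∃ c : ℂ, e N (2 * k + 2) (k + 2) z - c • e N (2 * k + 2) (k + 2) (row x r (2 * k + 2) 1) ∈
      boundaries N (2 * k + 2) := by
  obtain ⟨a, b, hab⟩ := D.exists_sub_sum_mem hfin (2 * k + 1) z hz
  obtain ⟨c, hc⟩ := D.e_row_even_zero hfin k (k + 2)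
  rw [if_neg (by omega), sub_zero] at hc
  -- Applying the idempotent once more replaces the correction by its own projection.
  have h1 := Submodule.smul_mem _ a (e_mem_boundaries (k + 2) hc)
  have h2 := e_mem_boundaries (k + 2) hab
  simp only [map_sub, map_add, map_smul, e_e_self] at h1 h2
  refine ⟨a * c + b, ?_⟩
  convert Submodule.add_mem _ h1 h2 using 1
  module

theorem e_even_bot (D : Detector x r)
    (hfin : ∀ n, Module.Finite ℂ (Hoch N (n + 1)) ∧ Module.finrank ℂ (Hoch N (n + 1)) ≤ 2)
    (k : ℕ) (z : ⨂[ℂ]^(2 * k + 2) N) (hz : z ∈ cycles N (2 * k + 2)) :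
    ∃ c : ℂ, e N (2 * k + 2) (k + 1) z - c • e N (2 * k + 2) (k + 1) (row x r (2 * k + 2) 0) ∈
      boundaries N (2 * k + 2) := by
  obtain ⟨a, b, hab⟩ := D.exists_sub_sum_mem hfin (2 * k + 1) z hz
  have h1 := D.e_row_even_one hfin k (k + 1)
  rw [if_neg (by omega), sub_zero] at h1
  have h2 := e_mem_boundaries (k + 1) hab
  simp only [map_sub, map_add, map_smul] at h2
  refine ⟨a, ?_⟩
  convert Submodule.add_mem _ h2 (Submodule.smul_mem _ b h1) using 1
  module

theorem e_even_other (D : Detector x r)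
    (hfin : ∀ n, Module.Finite ℂ (Hoch N (n + 1)) ∧ Module.finrank ℂ (Hoch N (n + 1)) ≤ 2)
    (k i : ℕ) (h1 : i ≠ k + 1) (h2 : i ≠ k + 2) (z : ⨂[ℂ]^(2 * k + 2) N)
    (hz : z ∈ cycles N (2 * k + 2)) : e N (2 * k + 2) i z ∈ boundaries N (2 * k + 2) := by
  obtain ⟨a, b, hab⟩ := D.exists_sub_sum_mem hfin (2 * k + 1) z hz
  obtain ⟨c, hc⟩ := D.e_row_even_zero hfin k i
  rw [if_neg h1, sub_zero] at hc
  have h3 := D.e_row_even_one hfin k i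
  rw [if_neg h2, sub_zero] at h3
  have h4 := Submodule.smul_mem _ a (e_mem_boundaries i hc)
  have h5 := e_mem_boundaries i hab
  simp only [map_sub, map_add, map_smul, e_e_self] at h4 h5
  have := Submodule.add_mem _ (Submodule.add_mem _ h4 h5) (Submodule.smul_mem _ (a * c + b) h3)
  convert this using 1
  module

/-- On homology `e_p + e_q` is the identity, because the other idempotents in `sum_e` vanish there;
orthogonality makes the two images disjoint. -/
theorem isCompl_range_toHoch (n p q : ℕ) (hp : p ≤ n) (hq : q ≤ n) (hpq : p ≠ q)
    (h : ∀ i, i ≠ p → i ≠ q → ∀ z ∈ cycles N n, e N n i z ∈ boundaries N n) :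
    IsCompl (LinearMap.range (toHoch N n p)) (LinearMap.range (toHoch N n q)) := by
  constructor
  · rw [Submodule.disjoint_def]
    rintro _ ⟨u, rfl⟩ ⟨v, hv⟩
    obtain ⟨z, hz, rfl⟩ := exists_compClass u
    obtain ⟨w, hw, rfl⟩ := exists_compClass v
    rw [toHoch_compClass, toHoch_compClass, hochClass_eq_iff] at hv
    have h1 := e_mem_boundaries p hv
    rw [map_sub, mem_comp.1 hz.2, ← mem_comp.1 hw.2, e_e, if_neg hpq, zero_sub] at h1
    rw [toHoch_compClass]
    refine (hochClass_eq_iff hz.1 (Submodule.zero_mem _)).2 ?_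
    simpa using h1
  · rw [codisjoint_iff, eq_top_iff]
    rintro u -
    obtain ⟨z, hz, rfl⟩ := exists_hochClass u
    have hsum : z - (e N n p z + e N n q z) ∈ boundaries N n := by
      have h1 := LinearMap.congr_fun (sum_e N n) z
      rw [LinearMap.sum_apply, LinearMap.id_apply] at h1
      have h2 : e N n p z + e N n q z = ∑ i ∈ Finset.range (n + 1),
          ((if i = p then e N n i z else 0) + if i = q then e N n i z else 0) := by
        rw [Finset.sum_add_distrib, Finset.sum_ite_eq', Finset.sum_ite_eq',
          if_pos (Finset.mem_range.2 (by omega)), if_pos (Finset.mem_range.2 (by omega))]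
      rw [h2]
      nth_rewrite 1 [← h1]
      rw [← Finset.sum_sub_distrib]
      refine Submodule.sum_mem _ fun i _ => ?_
      by_cases hip : i = p
      · have : i ≠ q := fun hh => hpq (hip.symm.trans hh)
        simp [hip, hpq]
      · by_cases hiq : i = q
        · simp [hiq, hpq.symm]
        · simpa [hip, hiq] using h i hip hiq z hz
    have hmem : e N n p z + e N n q z ∈ cycles N n :=
      Submodule.add_mem _ (e_mem_cycles p hz) (e_mem_cycles q hz)
    rw [(hochClass_eq_iff hz hmem).2 hsum]
    exact Submodule.mem_sup.2 ⟨_, ⟨compClass N n p _ (e_mem_cyclesComp p hz), rfl⟩, _,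
      ⟨compClass N n q _ (e_mem_cyclesComp q hz), rfl⟩, rfl⟩

/-- The decomposition in even degrees. -/
theorem even_decomposition (D : Detector x r)
    (hfin : ∀ n, Module.Finite ℂ (Hoch N (n + 1)) ∧ Module.finrank ℂ (Hoch N (n + 1)) ≤ 2)
    (k : ℕ) :
    (Function.Injective (toHoch N (2 * k + 2) (k + 1)) ∧
      Function.Injective (toHoch N (2 * k + 2) (k + 2)) ∧
      IsCompl (LinearMap.range (toHoch N (2 * k + 2) (k + 1)))
        (LinearMap.range (toHoch N (2 * k + 2) (k + 2))) ∧
      Module.finrank ℂ (HComp N (2 * k + 2) (k + 1)) = 1 ∧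
      Module.finrank ℂ (HComp N (2 * k + 2) (k + 2)) = 1 ∧
      ∀ j, j ≠ k + 1 → j ≠ k + 2 → Subsingleton (HComp N (2 * k + 2) j)) ∧
    (∃ (h : e N (2 * k + 2) (k + 1) (row x r (2 * k + 2) 0) ∈ cyclesComp N (2 * k + 2) (k + 1))
      (b : Module.Basis (Fin 1) ℂ (HComp N (2 * k + 2) (k + 1))),
      b 0 = compClass N (2 * k + 2) (k + 1) _ h) ∧
    (∃ (h : e N (2 * k + 2) (k + 2) (row x r (2 * k + 2) 1) ∈ cyclesComp N (2 * k + 2) (k + 2))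
      (b : Module.Basis (Fin 1) ℂ (HComp N (2 * k + 2) (k + 2))),
      b 0 = compClass N (2 * k + 2) (k + 2) _ h) := by
  have hp := e_mem_cyclesComp (k + 1) (row_mem_cycles x r D.rel (2 * k + 2) 0)
  have hq := e_mem_cyclesComp (k + 2) (row_mem_cycles x r D.rel (2 * k + 2) 1)
  obtain ⟨bp, hbp⟩ := exists_basis_hComp hp (by
      intro hmem
      obtain ⟨c, hc⟩ := D.e_row_even_zero hfin k (k + 1)
      rw [if_pos rfl] at hc
      have h1 := Submodule.sub_mem _ hmem hc
      -- Modulo exact chains the projected first row is the first row plus `c` times the second,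
      -- which is not exact whatever `c` is.
      have := D.eq_zero_of_sum_mem (2 * k + 1) ![1, c] (by
        convert h1 using 1
        simp [Fin.sum_univ_two]
        module)
      simpa using congrFun this 0)
    (fun z hz => by
      obtain ⟨c, hc⟩ := D.e_even_bot hfin k z hz.1
      rw [mem_comp.1 hz.2] at hc
      exact ⟨c, hc⟩)
  obtain ⟨bq, hbq⟩ := exists_basis_hComp hq (by
      intro hmem
      have hc := D.e_row_even_one hfin k (k + 2)
      rw [if_pos rfl] at hc
      have h1 := Submodule.sub_mem _ hmem hc
      have := D.eq_zero_of_sum_mem (2 * k + 1) ![0, 1] (by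
        convert h1 using 1
        simp [Fin.sum_univ_two])
      simpa using congrFun this 1)
    (fun z hz => by
      obtain ⟨c, hc⟩ := D.e_even_top hfin k z hz.1
      rw [mem_comp.1 hz.2] at hc
      exact ⟨c, hc⟩)
  refine ⟨⟨toHoch_injective _ _, toHoch_injective _ _, ?_, ?_, ?_, ?_⟩, ⟨hp, bp, hbp⟩,
    ⟨hq, bq, hbq⟩⟩
  · exact isCompl_range_toHoch _ _ _ (by omega) (by omega) (by omega)
      fun i h1 h2 z hz => D.e_even_other hfin k i h1 h2 z hz
  · rw [Module.finrank_eq_card_basis bp, Fintype.card_fin]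
  · rw [Module.finrank_eq_card_basis bq, Fintype.card_fin]
  · exact fun j h1 h2 => subsingleton_hComp fun z hz => D.e_even_other hfin k j h1 h2 z hz

end Detector

end PlaneCurve
end

noncomputable section

set_option linter.unusedSectionVars false
set_option linter.unusedSimpArgs false

namespace PlaneCurve

/-! ### The plane curve: augmentation, matrix factorization, detecting cocycles -/

section CurveAlgebra

open MvPolynomial

theorem mem_maxIdeal {f : MvPolynomial (Fin 2) ℂ} : f ∈ maxIdeal ↔ constantCoeff f = 0 := by
  constructor
  · intro hf
    have : maxIdeal ≤ RingHom.ker (constantCoeff (R := ℂ) (σ := Fin 2)) := by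
      rw [maxIdeal, Ideal.span_le]
      rintro _ (rfl | rfl) <;> simp [RingHom.mem_ker]
    exact this hf
  · intro hf
    have hs : ({X 0, X 1} : Set (MvPolynomial (Fin 2) ℂ)) = X '' Set.univ := by
      ext p
      simp only [Set.mem_insert_iff, Set.mem_singleton_iff, Set.image_univ, Set.mem_range,
        Fin.exists_fin_two]
      tauto
    rw [maxIdeal, hs, mem_ideal_span_X_image]
    intro m hm
    by_contra! h
    have : m = 0 := Finsupp.ext fun i => h i (Set.mem_univ i)
    rw [mem_support_iff, this] at hm
    exact hm hf

theorem constantCoeff_pderiv (f : MvPolynomial (Fin 2) ℂ) (i : Fin 2) :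
    constantCoeff (pderiv i f) = coeff (Finsupp.single i 1) f := by
  rw [constantCoeff_eq, coeff_pderiv]
  simp

theorem constantCoeff_pderiv_mul (f g : MvPolynomial (Fin 2) ℂ) (i : Fin 2) :
    constantCoeff (pderiv i (f * g)) = constantCoeff f * constantCoeff (pderiv i g) +
      constantCoeff g * constantCoeff (pderiv i f) := by
  simp [pderiv_mul]

/-- In any expression `R = a x₁ + b x₂` the constant terms of `a` and `b` are the linear
coefficients of `R`. -/
theorem exists_partials (R : MvPolynomial (Fin 2) ℂ) (hconst : constantCoeff R = 0)
    (hlin : ∀ i : Fin 2, coeff (Finsupp.single i 1) R = 0) :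
    ∃ S : Fin 2 → maxIdeal, ∑ i, X i * (S i : MvPolynomial (Fin 2) ℂ) = R := by
  obtain ⟨a, b, hab⟩ := Ideal.mem_span_pair.1 (mem_maxIdeal.2 hconst)
  have h : ∀ i, constantCoeff (pderiv i R) = 0 := fun i => by rw [constantCoeff_pderiv, hlin]
  rw [← hab] at h
  have ha := h 0
  have hb := h 1
  simp only [map_add, constantCoeff_pderiv_mul] at ha hb
  refine ⟨![⟨a, mem_maxIdeal.2 ?_⟩, ⟨b, mem_maxIdeal.2 ?_⟩], ?_⟩
  · simpa [pderiv_X] using ha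
  · simpa [pderiv_X] using hb
  · rw [← hab, Fin.sum_univ_two]
    simp only [Matrix.cons_val_zero, Matrix.cons_val_one]
    ring

variable (R : MvPolynomial (Fin 2) ℂ)

theorem exists_of_mk_eq {f g : MvPolynomial (Fin 2) ℂ}
    (h : Ideal.Quotient.mk (Ideal.span {R}) f = Ideal.Quotient.mk (Ideal.span {R}) g) :
    ∃ w, f = g + R * w := by
  obtain ⟨w, hw⟩ := Ideal.mem_span_singleton.1 (Ideal.Quotient.eq.1 h)
  exact ⟨w, by rw [← hw]; ring⟩

/-- The augmentation of the coordinate algebra. -/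
def curveAug (hconst : constantCoeff R = 0) : CoordRing R →ₐ[ℂ] ℂ :=
  Ideal.Quotient.liftₐ (Ideal.span {R}) (aeval (0 : Fin 2 → ℂ)) (by
    intro f hf
    obtain ⟨w, rfl⟩ := Ideal.mem_span_singleton.1 hf
    simp [← constantCoeff_eq, hconst])

theorem curveAug_mk (hconst : constantCoeff R = 0) (f : MvPolynomial (Fin 2) ℂ) :
    curveAug R hconst (Ideal.Quotient.mk _ f) = constantCoeff f := by
  simp [curveAug]

theorem mem_Aplus (hconst : constantCoeff R = 0) {a : CoordRing R} :
    a ∈ Aplus R ↔ curveAug R hconst a = 0 := by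
  have h : a ∈ Aplus R ↔ a ∈ maxIdeal.map (Ideal.Quotient.mk (Ideal.span {R})) := Iff.rfl
  rw [h, Ideal.mem_map_iff_of_surjective _ Ideal.Quotient.mk_surjective]
  constructor
  · rintro ⟨f, hf, rfl⟩
    rw [curveAug_mk]
    exact mem_maxIdeal.1 hf
  · obtain ⟨f, rfl⟩ := Ideal.Quotient.mk_surjective a
    rw [curveAug_mk]
    exact fun hf => ⟨f, mem_maxIdeal.2 hf, rfl⟩

/-- The coordinate algebra as an augmented algebra. -/
def curveAugmentation (hconst : constantCoeff R = 0) :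
    Augmentation (Aplus R) (CoordRing R) where
  incl :=
    { toFun := fun a => a.1
      map_add' := fun _ _ => rfl
      map_smul' := fun _ _ => rfl }
  proj :=
    { toFun := fun a => ⟨a - algebraMap ℂ _ (curveAug R hconst a), by
        rw [mem_Aplus R hconst, map_sub, AlgHom.commutes]
        simp⟩
      map_add' := fun a b => Subtype.ext (by
        change _ = (a - algebraMap ℂ _ (curveAug R hconst a)) +
          (b - algebraMap ℂ _ (curveAug R hconst b))
        simp only [map_add]
        ring)
      map_smul' := fun c a => Subtype.ext (by
        change c • a - algebraMap ℂ _ (curveAug R hconst (c • a)) =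
          c • (a - algebraMap ℂ _ (curveAug R hconst a))
        rw [map_smul, smul_sub, smul_eq_mul, map_mul,
          Algebra.smul_def c (algebraMap ℂ (CoordRing R) (curveAug R hconst a))]) }
  aug := (curveAug R hconst).toLinearMap
  incl_mul := fun _ _ => rfl
  proj_mul := fun b a => Subtype.ext (by
    change (b : CoordRing R) * a - algebraMap ℂ _ (curveAug R hconst (b * a)) =
      b * (a - algebraMap ℂ _ (curveAug R hconst a)) + curveAug R hconst a • (b : CoordRing R)
    have h : curveAug R hconst a • (b : CoordRing R) =
      algebraMap ℂ (CoordRing R) (curveAug R hconst a) * b :=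
      Algebra.smul_def (A := CoordRing R) (curveAug R hconst a) (b : CoordRing R)
    rw [h, map_mul, (mem_Aplus R hconst).1 b.2, zero_mul, map_zero]
    ring)
  incl_proj := fun a => by
    change curveAug R hconst a • (1 : CoordRing R) +
      (a - algebraMap ℂ _ (curveAug R hconst a)) = a
    rw [Algebra.algebraMap_eq_smul_one]
    ring

theorem curveAugmentation_aug (hconst : constantCoeff R = 0) (a : CoordRing R) :
    (curveAugmentation R hconst).aug a = curveAug R hconst a := rfl

theorem curveAugmentation_act (hconst : constantCoeff R = 0) (b : Aplus R)
    (v : Fin 2 → CoordRing R) :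
    (curveAugmentation R hconst).act b v = (b : CoordRing R) • v := rfl

/-- The matrix factorization of `R`, read modulo `R`. -/
def curveMatrix (S : Fin 2 → maxIdeal) (n : ℕ) :
    Matrix (Fin 2) (Fin 2) (MvPolynomial (Fin 2) ℂ) :=
  if Odd n then !![(S 0 : MvPolynomial (Fin 2) ℂ), -X 1; (S 1 : MvPolynomial (Fin 2) ℂ), X 0]
  else !![X 0, X 1; -(S 1 : MvPolynomial (Fin 2) ℂ), (S 0 : MvPolynomial (Fin 2) ℂ)]

theorem curveMatrix_mulVec_mulVec (S : Fin 2 → maxIdeal)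
    (hS : ∑ i, X i * (S i : MvPolynomial (Fin 2) ℂ) = R) (n : ℕ)
    (v : Fin 2 → MvPolynomial (Fin 2) ℂ) :
    (curveMatrix S n).mulVec ((curveMatrix S (n + 1)).mulVec v) = R • v := by
  rw [Fin.sum_univ_two] at hS
  rw [← hS]
  by_cases hn : Odd n
  · have hn' : ¬ Odd (n + 1) := by simpa [Nat.odd_add_one] using hn
    funext i
    fin_cases i <;>
      simp only [curveMatrix, hn, hn', if_true, if_false, Matrix.mulVec, dotProduct,
        Fin.sum_univ_two, Matrix.of_apply, Matrix.cons_val', Matrix.cons_val_zero,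
        Matrix.cons_val_one, Matrix.cons_val_fin_one, Pi.smul_apply, smul_eq_mul, Fin.zero_eta,
        Fin.mk_one, Fin.isValue] <;> ring
  · have hn' : Odd (n + 1) := by simpa [Nat.odd_add_one] using hn
    funext i
    fin_cases i <;>
      simp only [curveMatrix, hn, hn', if_true, if_false, Matrix.mulVec, dotProduct,
        Fin.sum_univ_two, Matrix.of_apply, Matrix.cons_val', Matrix.cons_val_zero,
        Matrix.cons_val_one, Matrix.cons_val_fin_one, Pi.smul_apply, smul_eq_mul, Fin.zero_eta,
        Fin.mk_one, Fin.isValue] <;> ring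

theorem curveMatrix_add_two (S : Fin 2 → maxIdeal) (n : ℕ) :
    curveMatrix S (n + 2) = curveMatrix S n := by
  have : Odd (n + 2) ↔ Odd n := by simp [Nat.odd_add]
  simp [curveMatrix, this]

theorem constantCoeff_curveMatrix (S : Fin 2 → maxIdeal) (n : ℕ) (i j : Fin 2) :
    constantCoeff (curveMatrix S n i j) = 0 := by
  have h0 := mem_maxIdeal.1 (S 0).2
  have h1 := mem_maxIdeal.1 (S 1).2
  by_cases hn : Odd n <;> fin_cases i <;> fin_cases j <;> simp [curveMatrix, hn, h0, h1]

/-- The matrices acting on pairs over the coordinate algebra. -/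
def curveMap (S : Fin 2 → maxIdeal) (n : ℕ) :
    (Fin 2 → CoordRing R) →ₗ[CoordRing R] (Fin 2 → CoordRing R) :=
  ((curveMatrix S n).map (Ideal.Quotient.mk (Ideal.span {R}))).mulVecLin

theorem curveMap_mk (S : Fin 2 → maxIdeal) (n : ℕ) (v : Fin 2 → MvPolynomial (Fin 2) ℂ) :
    curveMap R S n (fun i => Ideal.Quotient.mk _ (v i)) =
      fun i => Ideal.Quotient.mk _ ((curveMatrix S n).mulVec v i) := by
  funext i
  simp only [curveMap, Matrix.mulVecLin_apply, Matrix.mulVec, dotProduct, Matrix.map_apply,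
    map_sum, map_mul]

theorem exists_lift (v : Fin 2 → CoordRing R) : ∃ w : Fin 2 → MvPolynomial (Fin 2) ℂ,
    v = fun i => Ideal.Quotient.mk _ (w i) :=
  ⟨fun i => (Ideal.Quotient.mk_surjective (v i)).choose,
    funext fun i => (Ideal.Quotient.mk_surjective (v i)).choose_spec.symm⟩

/-- If `M_n v = R w`, multiplying by `M_{n+1}` gives `R v = R M_{n+1} w`, and `R` can be cancelled.
-/
theorem curveMap_exact (hR : R ≠ 0) (S : Fin 2 → maxIdeal)
    (hS : ∑ i, X i * (S i : MvPolynomial (Fin 2) ℂ) = R) (n : ℕ) :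
    Function.Exact (curveMap R S (n + 1)) (curveMap R S n) := by
  have hR0 : Ideal.Quotient.mk (Ideal.span {R}) R = 0 :=
    Ideal.Quotient.eq_zero_iff_mem.2 (Ideal.mem_span_singleton_self R)
  intro v
  constructor
  · intro h
    obtain ⟨v, rfl⟩ := exists_lift R v
    rw [curveMap_mk] at h
    have h1 : ∀ i, ∃ w, (curveMatrix S n).mulVec v i = R * w := fun i => by
      obtain ⟨w, hw⟩ := exists_of_mk_eq R (g := 0) ((congrFun h i).trans (map_zero _).symm)
      exact ⟨w, by rw [hw, zero_add]⟩
    choose w hw using h1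
    refine ⟨fun i => Ideal.Quotient.mk _ (w i), ?_⟩
    rw [curveMap_mk]
    have h2 : R • v = R • (curveMatrix S (n + 1)).mulVec w := by
      rw [← curveMatrix_mulVec_mulVec R S hS (n + 1) v, curveMatrix_add_two,
        ← Matrix.mulVec_smul]
      congr 1
      funext i
      exact hw i
    have h3 : v = (curveMatrix S (n + 1)).mulVec w := by
      funext i
      exact mul_left_cancel₀ hR (congrFun h2 i)
    rw [← h3]
  · rintro ⟨v, rfl⟩
    obtain ⟨v, rfl⟩ := exists_lift R v
    rw [curveMap_mk, curveMap_mk]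
    funext i
    rw [curveMatrix_mulVec_mulVec R S hS]
    simp [hR0]

/-- The map `(v₁, v₂) ↦ x₁ v₁ + x₂ v₂`. -/
def curveCover : (Fin 2 → CoordRing R) →ₗ[ℂ] Aplus R where
  toFun v := ⟨∑ i, (cl R (coord i) : CoordRing R) * v i,
    Ideal.sum_mem (maxIdeal.map (Ideal.Quotient.mk (Ideal.span {R}))) fun i _ =>
      Ideal.mul_mem_right _ _ (cl R (coord i)).2⟩
  map_add' v w := Subtype.ext (by
    change _ = (∑ i, (cl R (coord i) : CoordRing R) * v i) + ∑ i, (cl R (coord i) : CoordRing R) * w i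
    simp only [Pi.add_apply, mul_add, Finset.sum_add_distrib])
  map_smul' c v := Subtype.ext (by
    change _ = c • (∑ i, (cl R (coord i) : CoordRing R) * v i)
    simp only [Pi.smul_apply, mul_smul_comm, Finset.smul_sum])

theorem curveCover_coe (v : Fin 2 → CoordRing R) :
    (curveCover R v : CoordRing R) = ∑ i, Ideal.Quotient.mk _ (X i) * v i := rfl

theorem curveCover_surjective : Function.Surjective (curveCover R) := by
  intro b
  obtain ⟨f, hf, hfb⟩ := (Ideal.mem_map_iff_of_surjective (Ideal.Quotient.mk (Ideal.span {R}))
    Ideal.Quotient.mk_surjective).1 b.2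
  obtain ⟨p, q, rfl⟩ := Ideal.mem_span_pair.1 hf
  refine ⟨![Ideal.Quotient.mk _ p, Ideal.Quotient.mk _ q], Subtype.ext ?_⟩
  rw [curveCover_coe, ← hfb, Fin.sum_univ_two]
  simp only [Matrix.cons_val_zero, Matrix.cons_val_one, map_add, map_mul]
  ring

/-- If `x₁v₁ + x₂v₂ = R w`, subtracting `w (R₁, R₂)` leaves a syzygy of `(x₁, x₂)` over the
polynomial ring. As `x₁` is prime and does not divide `x₂`, it is a Koszul syzygy; together these
are the columns of `M_1`. -/
theorem curveCover_exact (S : Fin 2 → maxIdeal)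
    (hS : ∑ i, X i * (S i : MvPolynomial (Fin 2) ℂ) = R) :
    Function.Exact (curveMap R S 1) (curveCover R) := by
  have hS' := hS
  rw [Fin.sum_univ_two] at hS'
  intro v
  obtain ⟨v, rfl⟩ := exists_lift R v
  have hcov : curveCover R (fun i => Ideal.Quotient.mk _ (v i)) = 0 ↔
      Ideal.Quotient.mk (Ideal.span {R}) (X 0 * v 0 + X 1 * v 1) = Ideal.Quotient.mk _ 0 := by
    rw [← Subtype.coe_inj, curveCover_coe, Fin.sum_univ_two, map_zero, map_add, map_mul, map_mul]
    rfl
  rw [hcov]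
  constructor
  · intro h
    obtain ⟨w, hw⟩ := exists_of_mk_eq R h
    rw [zero_add, ← hS'] at hw
    have h1 : X 0 * (v 0 - (S 0 : MvPolynomial (Fin 2) ℂ) * w) = X 1 * -(v 1 - (S 1 : MvPolynomial (Fin 2) ℂ) * w) := by linear_combination hw
    have h2 : (X 0 : MvPolynomial (Fin 2) ℂ) ∣ -(v 1 - (S 1 : MvPolynomial (Fin 2) ℂ) * w) := by
      refine ((X_prime (R := ℂ) (i := (0 : Fin 2))).dvd_or_dvd ⟨_, h1.symm⟩).resolve_left ?_
      rw [X_dvd_X]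
      simp
    obtain ⟨u, hu⟩ := h2
    have h3 : v 0 - (S 0 : MvPolynomial (Fin 2) ℂ) * w = X 1 * u := by
      refine mul_left_cancel₀ (X_ne_zero (R := ℂ) (0 : Fin 2)) ?_
      rw [h1, hu]
      ring
    refine ⟨fun i => Ideal.Quotient.mk _ (![w, -u] i), ?_⟩
    rw [curveMap_mk]
    funext i
    congr 1
    fin_cases i
    · simp [curveMatrix, Matrix.mulVec, dotProduct, Fin.sum_univ_two]
      linear_combination -h3
    · simp [curveMatrix, Matrix.mulVec, dotProduct, Fin.sum_univ_two]
      linear_combination hu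
  · rintro ⟨u, hu⟩
    obtain ⟨u, rfl⟩ := exists_lift R u
    rw [curveMap_mk] at hu
    have h0 := congrFun hu 0
    have h1 := congrFun hu 1
    rw [map_add, map_mul, map_mul, ← h0, ← h1, ← map_mul, ← map_mul, ← map_add,
      Ideal.Quotient.eq, sub_zero, Ideal.mem_span_singleton]
    refine ⟨u 0, ?_⟩
    rw [← hS']
    simp [curveMatrix, Matrix.mulVec, dotProduct, Fin.sum_univ_two]
    ring

/-- The periodic resolution of the augmentation ideal. -/
def curveResolution (hR : R ≠ 0) (hconst : constantCoeff R = 0) (S : Fin 2 → maxIdeal)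
    (hS : ∑ i, X i * (S i : MvPolynomial (Fin 2) ℂ) = R) :
    RankTwoResolution (curveAugmentation R hconst) where
  -- The shift is there because the relations among `x₁`, `x₂` are given by `M_1`.
  map s := (curveMap R S (s + 1)).restrictScalars ℂ
  cover := curveCover R
  map_act s a v := (curveMap R S (s + 1)).map_smul (a : CoordRing R) v
  cover_act a v := Subtype.ext (by
    rw [curveAugmentation_act]
    change _ = (a : CoordRing R) * (curveCover R v : CoordRing R)
    rw [curveCover_coe, curveCover_coe, Finset.mul_sum]
    exact Finset.sum_congr rfl fun i _ => by
      rw [Pi.smul_apply, smul_eq_mul]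
      ring)
  exact_map s := curveMap_exact R hR S hS (s + 1)
  exact_cover := curveCover_exact R S hS
  cover_surjective := curveCover_surjective R
  minimal s l i := by
    rw [curveAugmentation_aug, LinearMap.restrictScalars_apply]
    simp only [curveMap, Matrix.mulVecLin_apply, Matrix.mulVec, dotProduct, Matrix.map_apply,
      map_sum, map_mul, curveAug_mk, constantCoeff_curveMatrix, zero_mul, Finset.sum_const_zero]

/-- The cocycles detecting the classes on a plane curve. -/
theorem nonempty_detector (hR : R ≠ 0) (hconst : constantCoeff R = 0)
    (hlin : ∀ i : Fin 2, coeff (Finsupp.single i 1) R = 0) (S : Fin 2 → maxIdeal)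
    (hS : ∑ i, X i * (S i : MvPolynomial (Fin 2) ℂ) = R) :
    Nonempty (Detector (fun i => cl R (coord i)) fun i => cl R (S i)) := by
  obtain ⟨s, hs⟩ := (Ideal.Quotient.mkₐ ℂ (Ideal.span {R})).toLinearMap.exists_rightInverse_of_surjective
    (LinearMap.range_eq_top.2 Ideal.Quotient.mk_surjective)
  have hs : ∀ a : CoordRing R, Ideal.Quotient.mk (Ideal.span {R}) (s a) = a :=
    fun a => LinearMap.congr_fun hs a
  -- A linear extension of division by `R` to all polynomials; followed by evaluation at the origin
  -- it gives `L` with `L (R f) = f(0)`.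
  obtain ⟨g, hg⟩ := (LinearMap.mulLeft ℂ R).exists_leftInverse_of_injective
    (LinearMap.ker_eq_bot.2 fun a b h => mul_left_cancel₀ hR h)
  let ev : MvPolynomial (Fin 2) ℂ →ₗ[ℂ] ℂ := (aeval (0 : Fin 2 → ℂ)).toLinearMap
  have hev : ∀ f, ev f = constantCoeff f := fun f => by simp [ev]
  let L : MvPolynomial (Fin 2) ℂ →ₗ[ℂ] ℂ := ev ∘ₗ g
  have hL : ∀ f, L (R * f) = constantCoeff f := fun f => by
    have := LinearMap.congr_fun hg f
    simp only [LinearMap.comp_apply, LinearMap.mulLeft_apply, LinearMap.id_apply] at this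
    simp only [L, LinearMap.comp_apply, this, hev]
  have hconst_s : ∀ a : Aplus R, constantCoeff (s a) = 0 := fun a => by
    rw [← curveAug_mk R hconst, hs]
    exact (mem_Aplus R hconst).1 a.2
  have hmul : ∀ a b : CoordRing R, ∃ f, s (a * b) = s a * s b + R * f := fun a b =>
    exists_of_mk_eq R (by rw [hs, map_mul, hs, hs])
  have hcl : ∀ f : maxIdeal, ∃ w, s (cl R f) = f + R * w := fun f =>
    exists_of_mk_eq R (by rw [hs]; rfl)
  have hpd : ∀ (f : MvPolynomial (Fin 2) ℂ) (i : Fin 2), constantCoeff (pderiv i (R * f)) = 0 := by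
    intro f i
    rw [constantCoeff_pderiv_mul, hconst, constantCoeff_pderiv, constantCoeff_pderiv, hlin]
    ring
  have hrel : ∑ i, cl R (coord i) * cl R (S i) = 0 := by
    apply Subtype.ext
    rw [Fin.sum_univ_two] at hS ⊢
    change Ideal.Quotient.mk (Ideal.span {R}) (X 0) * Ideal.Quotient.mk _ _ +
      Ideal.Quotient.mk _ (X 1) * Ideal.Quotient.mk _ _ = 0
    rw [← map_mul, ← map_mul, ← map_add, hS]
    exact Ideal.Quotient.eq_zero_iff_mem.2 (Ideal.mem_span_singleton_self R)
  -- Since `s a * s b - s (a * b)` is a multiple `R f`, the form takes the value `f(0)`.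
  refine ⟨{ form := LinearMap.mk₂ ℂ (fun a b : Aplus R => L (s a * s b) - L (s (a * b : Aplus R)))
              ?_ ?_ ?_ ?_
            form_symm := ?_
            form_mul := ?_
            form_rel := ?_
            lin := fun i =>
              { toFun := fun a => coeff (Finsupp.single i 1) (s a)
                map_add' := fun a b => ?_
                map_smul' := fun c a => ?_ }
            lin_mul := ?_
            lin_coord := ?_
            rel := hrel }⟩
  · intro a b c
    simp only [NonUnitalSubalgebra.coe_add, NonUnitalSubalgebra.coe_mul, map_add, add_mul]
    ring
  · intro r a b
    simp only [NonUnitalSubalgebra.coe_smul, NonUnitalSubalgebra.coe_mul, map_smul,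
      smul_mul_assoc, smul_sub]
  · intro a b c
    simp only [NonUnitalSubalgebra.coe_add, NonUnitalSubalgebra.coe_mul, map_add, mul_add]
    ring
  · intro r a b
    simp only [NonUnitalSubalgebra.coe_smul, NonUnitalSubalgebra.coe_mul, map_smul,
      mul_smul_comm, smul_sub]
  · intro a b
    simp only [LinearMap.mk₂_apply, mul_comm]
  · intro a b c
    simp only [LinearMap.mk₂_apply, NonUnitalSubalgebra.coe_mul, mul_assoc]
    -- Both sides differ from `L (s a * s b * s c) - L (s (a * b * c))` by `L` of `R` times a
    -- polynomial without constant term, which is zero.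
    obtain ⟨f, hf⟩ := hmul a b
    obtain ⟨f', hf'⟩ := hmul b c
    rw [hf, hf', show (s a * s b + R * f) * s c = s a * s b * s c + R * (f * s c) by ring,
      show s a * (s b * s c + R * f') = s a * s b * s c + R * (s a * f') by ring, map_add, map_add,
      hL, hL, map_mul constantCoeff, map_mul constantCoeff, hconst_s, hconst_s]
    ring
  · have h1 : ∀ i, L (s (cl R (coord i)) * s (cl R (S i))) =
        L (X i * (S i : MvPolynomial (Fin 2) ℂ)) := by
      intro i
      obtain ⟨w, hw⟩ := hcl (coord i)
      obtain ⟨w', hw'⟩ := hcl (S i)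
      -- Replacing the chosen lifts by `xᵢ` and `Rᵢ` changes the product by `R` times a polynomial
      -- vanishing at the origin, so the sum becomes `L R = 1`.
      rw [hw, hw', show ((coord i : MvPolynomial (Fin 2) ℂ) + R * w) * (S i + R * w') =
        coord i * S i + R * (w * S i + coord i * w' + R * (w * w')) by ring, map_add, hL]
      simp only [map_add, map_mul, mem_maxIdeal.1 (S i).2, mem_maxIdeal.1 (coord i).2, hconst]
      simp [coord]
    simp only [LinearMap.mk₂_apply, h1, Finset.sum_sub_distrib, ← map_sum]
    rw [hS]
    have h2 : ∑ i, ((cl R (coord i) * cl R (S i) : Aplus R) : CoordRing R) = 0 := by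
      have := congrArg (fun a : Aplus R => (a : CoordRing R)) hrel
      rw [Fin.sum_univ_two] at this ⊢
      exact this
    rw [h2, map_zero, map_zero, sub_zero]
    simpa using hL 1
  · simp only [NonUnitalSubalgebra.coe_add, map_add, coeff_add]
  · simp only [NonUnitalSubalgebra.coe_smul, map_smul, coeff_smul, RingHom.id_apply]
  · intro i a b
    change coeff (Finsupp.single i 1) (s (a * b : CoordRing R)) = 0
    obtain ⟨f, hf⟩ := hmul a b
    rw [← constantCoeff_pderiv, hf, map_add, map_add, hpd, constantCoeff_pderiv_mul, hconst_s,
      hconst_s]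
    ring
  · intro i j
    change coeff (Finsupp.single i 1) (s (cl R (coord j))) = _
    obtain ⟨w, hw⟩ := hcl (coord j)
    rw [← constantCoeff_pderiv, hw, map_add, map_add, hpd, add_zero]
    simp [coord, pderiv_X, Pi.single_apply, eq_comm, apply_ite]

end CurveAlgebra

end PlaneCurve
end

/-! ### From the rows to the chains `Pⁿ`, and the conclusion -/

namespace PlaneCurve

theorem finite_hoch_Aplus (R : MvPolynomial (Fin 2) ℂ) (hR : R ≠ 0)
    (hconst : MvPolynomial.constantCoeff R = 0) (S : Fin 2 → maxIdeal)
    (hS : ∑ i, MvPolynomial.X i * (S i : MvPolynomial (Fin 2) ℂ) = R) (n : ℕ) :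
    Module.Finite ℂ (Hoch (Aplus R) (n + 1)) ∧ Module.finrank ℂ (Hoch (Aplus R) (n + 1)) ≤ 2 :=
  (curveResolution R hR hconst S hS).finite_hoch_and_finrank_le n

namespace Detector

variable {N : Type*} [NonUnitalCommRing N] [Module ℂ N] [IsScalarTower ℂ N N]
  [SMulCommClass ℂ N N] {x r : Fin 2 → N}

theorem exists_basis_hoch_P (D : Detector x r)
    (hfin : ∀ n, Module.Finite ℂ (Hoch N (n + 1)) ∧ Module.finrank ℂ (Hoch N (n + 1)) ≤ 2)
    (n : ℕ) (hn : 1 ≤ n) :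
    ∃ (h : ∀ i, P N x r n i ∈ cycles N n) (b : Module.Basis (Fin 2) ℂ (Hoch N n)),
      ∀ i, b i = hochClass N n _ (h i) := by
  obtain ⟨n, rfl⟩ := Nat.exists_eq_add_of_le' hn
  rw [P_succ_eq_row]
  exact ⟨_, D.exists_basis_hoch n (hfin n).1 (hfin n).2⟩

theorem exists_basis_hComp_P (D : Detector x r)
    (hfin : ∀ n, Module.Finite ℂ (Hoch N (n + 1)) ∧ Module.finrank ℂ (Hoch N (n + 1)) ≤ 2)
    (k : ℕ) (hk : 1 ≤ k) :
    (∃ (h : e N (2 * k) k (P N x r (2 * k) 0) ∈ cyclesComp N (2 * k) k)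
      (b : Module.Basis (Fin 1) ℂ (HComp N (2 * k) k)), b 0 = compClass N (2 * k) k _ h) ∧
    (∃ (h : e N (2 * k) (k + 1) (P N x r (2 * k) 1) ∈ cyclesComp N (2 * k) (k + 1))
      (b : Module.Basis (Fin 1) ℂ (HComp N (2 * k) (k + 1))),
      b 0 = compClass N (2 * k) (k + 1) _ h) ∧
    (∃ (h : ∀ i, e N (2 * k - 1) k (P N x r (2 * k - 1) i) ∈ cyclesComp N (2 * k - 1) k)
      (b : Module.Basis (Fin 2) ℂ (HComp N (2 * k - 1) k)),
      ∀ i, b i = compClass N (2 * k - 1) k _ (h i)) := by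
  obtain ⟨k, rfl⟩ := Nat.exists_eq_add_of_le' hk
  have heven := (D.even_decomposition hfin k).2
  have hodd := (D.odd_decomposition hfin k).2
  rw [← P_succ_eq_row] at heven hodd
  exact ⟨heven.1, heven.2, hodd⟩

end Detector

end PlaneCurve

theorem theorem3p8 (R : MvPolynomial (Fin 2) ℂ) (hR : R ≠ 0)
    (hconst : MvPolynomial.constantCoeff R = 0)
    (hlin : ∀ i : Fin 2, MvPolynomial.coeff (Finsupp.single i 1) R = 0) :
    -- the decomposition of the homology
    (∀ k : ℕ, 1 ≤ k →
      -- even degrees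
      (Function.Injective (PlaneCurve.toHoch (PlaneCurve.Aplus R) (2 * k) k) ∧
        Function.Injective (PlaneCurve.toHoch (PlaneCurve.Aplus R) (2 * k) (k + 1)) ∧
        IsCompl (LinearMap.range (PlaneCurve.toHoch (PlaneCurve.Aplus R) (2 * k) k))
          (LinearMap.range (PlaneCurve.toHoch (PlaneCurve.Aplus R) (2 * k) (k + 1))) ∧
        Module.finrank ℂ (PlaneCurve.HComp (PlaneCurve.Aplus R) (2 * k) k) = 1 ∧
        Module.finrank ℂ (PlaneCurve.HComp (PlaneCurve.Aplus R) (2 * k) (k + 1)) = 1 ∧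
        ∀ j : ℕ, j ≠ k → j ≠ k + 1 →
          Subsingleton (PlaneCurve.HComp (PlaneCurve.Aplus R) (2 * k) j)) ∧
      -- odd degrees
      (Function.Bijective (PlaneCurve.toHoch (PlaneCurve.Aplus R) (2 * k - 1) k) ∧
        Module.finrank ℂ (PlaneCurve.HComp (PlaneCurve.Aplus R) (2 * k - 1) k) = 2 ∧
        ∀ j : ℕ, j ≠ k →
          Subsingleton (PlaneCurve.HComp (PlaneCurve.Aplus R) (2 * k - 1) j))) ∧
    -- the representative chains
    (∃ S : Fin 2 → PlaneCurve.maxIdeal,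
      ∑ i, MvPolynomial.X i * (S i : MvPolynomial (Fin 2) ℂ) = R) ∧
    (∀ S : Fin 2 → PlaneCurve.maxIdeal,
      ∑ i, MvPolynomial.X i * (S i : MvPolynomial (Fin 2) ℂ) = R →
      -- the two chains of each row are closed, and their classes are a basis
      (∀ n : ℕ, 1 ≤ n →
        ∃ (h : ∀ i : Fin 2, PlaneCurve.curveP R S n i ∈
              PlaneCurve.cycles (PlaneCurve.Aplus R) n)
          (b : Module.Basis (Fin 2) ℂ (PlaneCurve.Hoch (PlaneCurve.Aplus R) n)),
          ∀ i : Fin 2, b i = PlaneCurve.hochClass (PlaneCurve.Aplus R) n _ (h i)) ∧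
      -- their projections are bases of the components
      (∀ k : ℕ, 1 ≤ k →
        (∃ (h : PlaneCurve.e (PlaneCurve.Aplus R) (2 * k) k (PlaneCurve.curveP R S (2 * k) 0) ∈
              PlaneCurve.cyclesComp (PlaneCurve.Aplus R) (2 * k) k)
          (b : Module.Basis (Fin 1) ℂ (PlaneCurve.HComp (PlaneCurve.Aplus R) (2 * k) k)),
          b 0 = PlaneCurve.compClass (PlaneCurve.Aplus R) (2 * k) k _ h) ∧
        (∃ (h : PlaneCurve.e (PlaneCurve.Aplus R) (2 * k) (k + 1)
              (PlaneCurve.curveP R S (2 * k) 1) ∈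
              PlaneCurve.cyclesComp (PlaneCurve.Aplus R) (2 * k) (k + 1))
          (b : Module.Basis (Fin 1) ℂ (PlaneCurve.HComp (PlaneCurve.Aplus R) (2 * k) (k + 1))),
          b 0 = PlaneCurve.compClass (PlaneCurve.Aplus R) (2 * k) (k + 1) _ h) ∧
        (∃ (h : ∀ i : Fin 2, PlaneCurve.e (PlaneCurve.Aplus R) (2 * k - 1) k
              (PlaneCurve.curveP R S (2 * k - 1) i) ∈
              PlaneCurve.cyclesComp (PlaneCurve.Aplus R) (2 * k - 1) k)
          (b : Module.Basis (Fin 2) ℂ (PlaneCurve.HComp (PlaneCurve.Aplus R) (2 * k - 1) k)),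
          ∀ i : Fin 2, b i = PlaneCurve.compClass (PlaneCurve.Aplus R) (2 * k - 1) k _ (h i)))) := by
  have hS₀ := (PlaneCurve.exists_partials R hconst hlin).choose_spec
  -- The bound does not mention the decomposition of `R`, so one choice serves for all of them.
  have hfin := PlaneCurve.finite_hoch_Aplus R hR hconst _ hS₀
  refine ⟨fun k hk => ?_, ⟨_, hS₀⟩, fun S hS => ⟨fun n hn => ?_, fun k hk => ?_⟩⟩
  · have D := (PlaneCurve.nonempty_detector R hR hconst hlin _ hS₀).some
    -- With `k` written as `(k - 1) + 1`, the degrees `2k` and `2k - 1` unfold to `2(k - 1) + 2` and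
    -- `2(k - 1) + 1`.
    rw [← Nat.sub_add_cancel hk]
    exact ⟨(D.even_decomposition hfin (k - 1)).1, (D.odd_decomposition hfin (k - 1)).1⟩
  · exact (PlaneCurve.nonempty_detector R hR hconst hlin S hS).some.exists_basis_hoch_P hfin n hn
  · exact (PlaneCurve.nonempty_detector R hR hconst hlin S hS).some.exists_basis_hComp_P hfin k hk
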